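/- **Setting.** Let $\mathcal P=\{x\in\mathbb R^p: Cx\le b\}$ ($C$ a real matrix with rows $C_1,\dots,C_c$, $b\in\mathbb R^c$) be compact with at least two points, $V$ its finite set of vertices and $D>0$ its diameter. For $i=1,\dots,n$ ($n\ge 1$) let $f_i:\mathbb R^p\to\mathbb R$ be differentiable, strongly convex with parameter $\sigma_i>0$, with $L_i$-Lipschitz gradient. Put $F=\frac1n\sum_{i=1}^n f_i$, $F^*=\min_{\mathcal P}F$, $\sigma_F=\min_i\sigma_i$, $L_F=\max_i L_i$, and $\Omega_{\mathcal P}=\zeta/\varphi$, where $$\zeta=\min\{b_j-C_jv:\ v\in V,\ b_j>C_jv\},\qquad \varphi=\max\{\|C_j\|:\ C_jv<b_j\text{ for some }v\in V\}.$$ **Algorithm (Away-step Stochastic Frank-Wolfe).** Start with a vertex $x^{(1)}\in V$, active set $U^{(1)}=\{x^{(1)}\}$, and weights $\mu^{(1)}_{x^{(1)}}=1$, $\mu^{(1)}_v=0$ for $v\ne x^{(1)}$. In iteration $k=1,2,\dots$, draw a fresh batch $\xi_1,\dots,\xi_{m^{(k)}}$, all samples of all iterations being independent and uniform on $\{1,\dots,n\}$;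 put $F^{(k)}=\frac1{m^{(k)}}\sum_i f_{\xi_i}$, $g^{(k)}=\nabla F^{(k)}(x^{(k)})$, $L^{(k)}=\frac1{m^{(k)}}\sum_i L_{\xi_i}$. Choose a vertex $p^{(k)}\in V$ minimizing $\langle g^{(k)},\cdot\rangle$ over $\mathcal P$ and $u^{(k)}\in U^{(k)}$ maximizing it over $U^{(k)}$ (ties broken arbitrarily). * If $\langle g^{(k)},p^{(k)}+u^{(k)}-2x^{(k)}\rangle\le 0$ (Frank-Wolfe step), let $d^{(k)}=p^{(k)}-x^{(k)}$, $\gamma^{(k)}_{\max}=1$. * Otherwise (away step), let $d^{(k)}=x^{(k)}-u^{(k)}$, $\gamma^{(k)}_{\max}=\mu^{(k)}_{u^{(k)}}/(1-\mu^{(k)}_{u^{(k)}})$. Take $\gamma^{(k)}=\min\{-\langle g^{(k)},d^{(k)}\rangle/(L^{(k)}\|d^{(k)}\|^2),\gamma^{(k)}_{\max}\}$ (read as $0$ if $d^{(k)}=0$), or let $\gamma^{(k)}$ be an exact minimizer of $\gamma\mapsto F^{(k)}(x^{(k)}+\gamma d^{(k)})$ on $[0,\gamma^{(k)}_{\max}]$,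 and set $x^{(k+1)}=x^{(k)}+\gamma^{(k)}d^{(k)}$. The representation is updated as follows. After a Frank-Wolfe step all weights are multiplied by $1-\gamma^{(k)}$ and then $\gamma^{(k)}$ is added to that of $p^{(k)}$; the new active set is $\{p^{(k)}\}$ if the new weight of $p^{(k)}$ is $1$, and $U^{(k)}\cup\{p^{(k)}\}$ otherwise. After an away step all weights are multiplied by $1+\gamma^{(k)}$ and then $\gamma^{(k)}$ is subtracted from that of $u^{(k)}$; $u^{(k)}$ is removed from the active set if its new weight is $0$. There are two versions of the algorithm: in the first nothing else is done; in the second, every update ends with a Carathéodory reduction, which replaces the representation of $x^{(k+1)}$ by a convex representation of the same point by at most $p+1$ of the currently active vertices. Let $N=|V|$ in the first version and $N=p+1$ in the second. **Theorem.** For either version, let $$\rho=\min\Big\{\frac12,\frac{\Omega_{\mathcal P}^2\sigma_F}{16N^2L_FD^2}\Big\}$$ and use the batch sizes $m^{(k)}=\lceil (1-\rho)^{-(2k+2)}\rceil$. Then there are deterministic constants $C_2$ and $\beta$ with $0<\beta<\rho\le\frac12$, not depending on the run of the algorithm, such that for every $k\ge1$ $$\mathbb E\big[F(x^{(k+1)})-F^*\big]\le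 C_2(1-\beta)^{(k-1)/2}.$$ -/

import Mathlib

open MeasureTheory ProbabilityTheory
open scoped NNReal ENNReal

noncomputable section

namespace ASFW

/-- `ℝ^p` with the Euclidean norm. -/
abbrev E (p : ℕ) : Type := EuclideanSpace ℝ (Fin p)

/-! ### The feasible polyhedron and its constants -/

section Geometry

variable {p c : ℕ} (C : Matrix (Fin c) (Fin p) ℝ) (b : Fin c → ℝ)

/-- The polyhedron `{x ∈ ℝ^p : C x ≤ b}`. -/
def polyhedron : Set (E p) := {x | ∀ j, (C.mulVec x.ofLp) j ≤ b j}

/-- The set `V` of vertices (extreme points) of the polyhedron. -/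
def vertices : Set (E p) := (polyhedron C b).extremePoints ℝ

/-- `I(V)`: the constraints that are active at every vertex. -/
def activeAtAllVertices : Set (Fin c) := {j | ∀ v ∈ vertices C b, (C.mulVec v.ofLp) j = b j}

/-- `ζ`: the least positive slack of a constraint at a vertex. -/
def zeta : ℝ :=
  sInf {t | ∃ v ∈ vertices C b, ∃ j, (C.mulVec v.ofLp) j < b j ∧ t = b j - (C.mulVec v.ofLp) j}

/-- `φ`: the largest Euclidean norm of a row of `C` whose constraint is not in `I(V)`. -/
def phi : ℝ :=
  sSup {t | ∃ j, j ∉ activeAtAllVertices C b ∧ t = ‖(WithLp.toLp 2 (C j) : E p)‖}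

/-- `Ω_P = ζ / φ`. -/
def Omega : ℝ := zeta C b / phi C b

/-- `N`: it is `p + 1` when the Carathéodory reduction is used, and `|V|` otherwise. -/
def vertexBound (cara : Bool) : ℕ := if cara then p + 1 else (vertices C b).ncard

/-- `ρ = min {1/2, Ω_P² σ_F / (16 N² L_F D²)}` with `σ_F = min σ_i`, `L_F = max L_i` and `D` the
diameter of the polytope. -/
def rho {n : ℕ} (σ : Fin n → ℝ) (L : Fin n → ℝ≥0) (cara : Bool) : ℝ :=
  min (1 / 2)
    ((Omega C b) ^ 2 * (⨅ i, σ i) /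
      (16 * (vertexBound C b cara : ℝ) ^ 2 * (⨆ i, (L i : ℝ)) *
        (Metric.diam (polyhedron C b)) ^ 2))

end Geometry

/-- The batch size `m^{(k)} = ⌈1 / (1 - ρ)^{2k + 2}⌉`. -/
def batchSize (ρ : ℝ) (k : ℕ) : ℕ := ⌈1 / (1 - ρ) ^ (2 * k + 2)⌉₊

/-! ### The objective and its sampled versions -/

section Objective

variable {n p m : ℕ}

/-- `F(x) = (1/n) ∑ f_i(x)`. -/
def objective (f : Fin n → E p → ℝ) (x : E p) : ℝ := (1 / (n : ℝ)) * ∑ i, f i x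

/-- `F* = min_{x ∈ P} F(x)`. -/
def optimalValue (f : Fin n → E p → ℝ) (P : Set (E p)) : ℝ := sInf (objective f '' P)

/-- `F^{(k)}(x) = (1/m) ∑ f_{ξ_i}(x)` for the batch `ξ_1, …, ξ_m`. -/
def sampledObjective (f : Fin n → E p → ℝ) (ξ : Fin m → Fin n) (x : E p) : ℝ :=
  (1 / (m : ℝ)) * ∑ i, f (ξ i) x

/-- The stochastic gradient `g^{(k)} = (1/m) ∑ ∇f_{ξ_i}(x)`. -/
def sampledGradient (f : Fin n → E p → ℝ) (ξ : Fin m → Fin n) (x : E p) : E p :=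
  (1 / (m : ℝ)) • ∑ i, gradient (f (ξ i)) x

/-- `L^{(k)} = (1/m) ∑ L_{ξ_i}`. -/
def sampledLipschitz (L : Fin n → ℝ≥0) (ξ : Fin m → Fin n) : ℝ :=
  (1 / (m : ℝ)) * ∑ i, (L (ξ i) : ℝ)

end Objective

/-! ### The algorithm -/

section Algorithm

variable {n p c m : ℕ}

/-- An iterate together with its vertex representation: the point `x^{(k)}`, the set `U^{(k)}` of
active vertices and the weights `μ^{(k)}`. -/
structure State (p : ℕ) where
  x : E p
  U : Finset (E p)
  w : E p → ℝ

open Classical in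
/-- The initial state: `x^{(1)} = v`, `U^{(1)} = {v}`, `μ_v = 1`, all other weights `0`. -/
def initialState (v : E p) : State p := ⟨v, {v}, fun y => if y = v then 1 else 0⟩

open Classical in
/-- Frank–Wolfe step of length `γ` towards the vertex `q`, with the update of the representation. -/
def fwUpdate (s : State p) (q : E p) (γ : ℝ) : State p where
  x := s.x + γ • (q - s.x)
  U := if s.w q * (1 - γ) + γ = 1 then {q} else insert q s.U
  w := fun v => if v = q then s.w q * (1 - γ) + γ else s.w v * (1 - γ)

open Classical in
/-- Away step of length `γ` from the vertex `u`, with the update of the representation. -/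
def awayUpdate (s : State p) (u : E p) (γ : ℝ) : State p where
  x := s.x + γ • (s.x - u)
  U := if s.w u * (1 + γ) - γ = 0 then s.U.erase u else s.U
  w := fun v => if v = u then s.w u * (1 + γ) - γ else s.w v * (1 + γ)

/-- `t` arises from `s` by applying Carathéodory's theorem to the vertex representation: the same
point, represented by at most `p + 1` of the active vertices. -/
def IsCaratheodoryReduction (s t : State p) : Prop :=
  t.x = s.x ∧ t.U ⊆ s.U ∧ t.U.card ≤ p + 1 ∧ (∀ v ∈ t.U, 0 ≤ t.w v) ∧ (∀ v, v ∉ t.U → t.w v = 0) ∧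
    ∑ v ∈ t.U, t.w v = 1 ∧ ∑ v ∈ t.U, t.w v • v = t.x

/-- The permitted step lengths along `d`, where `G` is the sampled objective, `g` its gradient at
`x` and `ℓ` its Lipschitz constant: the rule `min {-⟨g, d⟩ / (ℓ ‖d‖²), γ_max}`, or exact line search
on `[0, γ_max]`. -/
def IsStepLength (G : E p → ℝ) (g : E p) (ℓ : ℝ) (x d : E p) (γmax γ : ℝ) : Prop :=
  γ = min (-(inner ℝ g d) / (ℓ * ‖d‖ ^ 2)) γmax ∨
    (γ ∈ Set.Icc 0 γmax ∧ IsMinOn (fun t : ℝ => G (x + t • d)) (Set.Icc 0 γmax) γ)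

/-- One iteration of the Away-step Stochastic Frank–Wolfe algorithm with the batch `ξ` leads from
`s` to `s'`. The flag `cara` says whether the Carathéodory reduction is used. -/
def IsIteration (C : Matrix (Fin c) (Fin p) ℝ) (b : Fin c → ℝ) (f : Fin n → E p → ℝ)
    (L : Fin n → ℝ≥0) (cara : Bool) (ξ : Fin m → Fin n) (s s' : State p) : Prop :=
  ∃ (q u : E p) (γ : ℝ) (t : State p),
    -- the linear optimization oracle returns a vertex
    (q ∈ vertices C b ∧ IsMinOn (fun y => inner ℝ (sampledGradient f ξ s.x) y) (polyhedron C b) q) ∧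
    -- the away vertex
    (u ∈ s.U ∧ IsMaxOn (fun v => inner ℝ (sampledGradient f ξ s.x) v) (s.U : Set (E p)) u) ∧
    -- the choice of the direction, the step length and the update
    ((inner ℝ (sampledGradient f ξ s.x) (q + u - (2 : ℝ) • s.x) ≤ 0 ∧
        IsStepLength (sampledObjective f ξ) (sampledGradient f ξ s.x) (sampledLipschitz L ξ)
          s.x (q - s.x) 1 γ ∧
        t = fwUpdate s q γ) ∨
      (0 < inner ℝ (sampledGradient f ξ s.x) (q + u - (2 : ℝ) • s.x) ∧
        IsStepLength (sampledObjective f ξ) (sampledGradient f ξ s.x) (sampledLipschitz L ξ)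
          s.x (s.x - u) (s.w u / (1 - s.w u)) γ ∧
        t = awayUpdate s u γ)) ∧
    -- the optional last step of the update of the representation
    (if cara then IsCaratheodoryReduction t s' else s' = t)

/-- `s 1, s 2, …` is a sequence of states generated by the algorithm from a vertex `v`, where `ξ k`
is the batch drawn in iteration `k ≥ 1`. (The index `0` is not used.) -/
def IsRun (C : Matrix (Fin c) (Fin p) ℝ) (b : Fin c → ℝ) (f : Fin n → E p → ℝ)
    (L : Fin n → ℝ≥0) (cara : Bool) (v : E p) {M : ℕ → ℕ} (ξ : (k : ℕ) → Fin (M k) → Fin n)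
    (s : ℕ → State p) : Prop :=
  s 1 = initialState v ∧ ∀ k, 1 ≤ k → IsIteration C b f L cara (ξ k) (s k) (s (k + 1))

end Algorithm

/-- The samples of all iterations `k ≥ 1` are independent and uniformly distributed on the index
set `{1, …, n}`. -/
structure IsUniformSampling {n : ℕ} {Ω : Type*} [MeasurableSpace Ω] (μ : Measure Ω) {M : ℕ → ℕ}
    (ξ : (k : ℕ) → Fin (M k) → Ω → Fin n) : Prop where
  measurable : ∀ k, 1 ≤ k → ∀ i, Measurable (ξ k i)
  uniform : ∀ k, 1 ≤ k → ∀ i a, μ {ω | ξ k i ω = a} = (n : ℝ≥0∞)⁻¹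
  indep : iIndepFun (fun (q : Σ k : ℕ+, Fin (M k)) => ξ q.1 q.2) μ

end ASFW

end

/-! The analysis is pathwise, with a potential in which steps that drop a vertex cost nothing. Let W
be the difference between the away vertex and the oracle vertex, measured by the sampled gradient. A
Hoffman-type bound (`exists_inner_le_mul_vertex_gap`) gives slope ≤ K·distance·W towards every
feasible point. Combined with strong convexity, this yields 2τ·gap ≤ K²W², a Polyak–Łojasiewicz
inequality in W. The chosen direction has slope at least W/2, so each iteration
(`IsIteration.progress`) either contracts the gap of the sampled objective by 1 - β while adding at
most one active vertex, or removes an active vertex without increasing that objective.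

Put q = √(1 - β) and Φ = gap·q⁻¹^|U|. In the first case Φ is multiplied by at most q²·q⁻¹ = q, in
the second by at most q. Passing from the sampled objective to F costs an additive error
(`potential_step`). This error is uniform over the polytope: it is a constant times the ℓ¹ distance
between the batch frequencies and the uniform law. Hence the dependence of the iterates on the
batches is harmless, and no conditional expectation is needed.

The mean error is O(1/√m) by a variance bound, so O((1 - ρ)^k) for the given batch sizes. Since 1 -
ρ < q, the recursion EΦ ≤ q·EΦ + error decays like q^k (`exists_integrable_dominating`), and Φ
dominates the gap.

K comes from compactness and is not expressed through Ω_P; of ρ only 0 < ρ ≤ 1/2 is used. -/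

namespace ASFW

open Filter Topology

/-! ### Hoffman-type error bounds on the simplex -/

/-- A linear map that is injective at zero on a closed cone is bounded below on that cone. -/
lemma exists_norm_le_mul_norm_on_cone {X Y : Type*} [NormedAddCommGroup X] [NormedSpace ℝ X]
    [FiniteDimensional ℝ X] [NormedAddCommGroup Y] [NormedSpace ℝ Y] (T : X →ₗ[ℝ] Y) {K : Set X}
    (hK : IsClosed K) (hcone : ∀ a : ℝ, 0 < a → ∀ x ∈ K, a • x ∈ K)
    (hker : ∀ x ∈ K, T x = 0 → x = 0) : ∃ c > 0, ∀ x ∈ K, ‖x‖ ≤ c * ‖T x‖ := by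
  have : ProperSpace X := FiniteDimensional.proper ℝ X
  have hcont : Continuous T := T.continuous_of_finiteDimensional
  have hcpt : IsCompact (Metric.sphere (0 : X) 1 ∩ K) := (isCompact_sphere 0 1).inter_right hK
  have hunit : ∀ x ∈ K, x ≠ 0 → ‖x‖⁻¹ • x ∈ Metric.sphere (0 : X) 1 ∩ K := fun x hx hx0 =>
    ⟨by simp [norm_smul, hx0], hcone _ (inv_pos.2 (norm_pos_iff.2 hx0)) x hx⟩
  rcases (Metric.sphere (0 : X) 1 ∩ K).eq_empty_or_nonempty with he | hne
  · refine ⟨1, one_pos, fun x hx => ?_⟩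
    by_cases hx0 : x = 0
    · simp [hx0]
    · exact absurd (hunit x hx hx0) (by simp [he])
  · obtain ⟨x₀, ⟨hx₀, hx₀K⟩, hmin⟩ := hcpt.exists_isMinOn hne hcont.norm.continuousOn
    have hpos : 0 < ‖T x₀‖ := by
      refine norm_pos_iff.2 fun h => ?_
      have h1 := hker x₀ hx₀K h
      simp [h1] at hx₀
    refine ⟨‖T x₀‖⁻¹, inv_pos.2 hpos, fun x hx => ?_⟩
    by_cases hx0 : x = 0
    · simp [hx0]
    · have h1 : ‖T x₀‖ ≤ ‖T (‖x‖⁻¹ • x)‖ := hmin (hunit x hx hx0)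
      have hxp := norm_pos_iff.2 hx0
      rw [map_smul, norm_smul, norm_inv, norm_norm, inv_mul_eq_div, le_div_iff₀ hxp] at h1
      rw [inv_mul_eq_div, le_div_iff₀ hpos]
      linarith

/-- The closed cone of vectors whose signs conform to a given sign pattern. -/
def signCone {ι : Type*} (s : ι → SignType) : Set (ι → ℝ) :=
  {η | ∀ v, 0 ≤ (s v : ℝ) * η v ∧ (s v = 0 → η v = 0)}

lemma isClosed_signCone {ι : Type*} (s : ι → SignType) : IsClosed (signCone s) := by
  simp only [signCone, Set.ofPred_forall, Set.ofPred_and]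
  refine isClosed_iInter fun v => IsClosed.inter ?_ (isClosed_iInter fun _ => ?_)
  · exact isClosed_le continuous_const (by fun_prop)
  · exact isClosed_eq (by fun_prop) continuous_const

/-- Hoffman-type error bound: the set of convex weights with prescribed image under a linear map
depends on the image in a Lipschitz manner. -/
lemma exists_stdSimplex_near {ι Y : Type*} [Fintype ι] [NormedAddCommGroup Y] [NormedSpace ℝ Y]
    (T : (ι → ℝ) →ₗ[ℝ] Y) : ∃ c > 0, ∀ w ∈ stdSimplex ℝ ι, ∀ z ∈ stdSimplex ℝ ι,
      ∃ l ∈ stdSimplex ℝ ι, T l = T z ∧ ‖l - w‖ ≤ c * ‖T z - T w‖ := by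
  classical
  -- Appending the coordinate sum to `T` makes kernel directions preserve total mass, so that they
  -- are admissible perturbations inside the simplex.
  let S : (ι → ℝ) →ₗ[ℝ] ℝ := ∑ v, LinearMap.proj v
  have hS : ∀ η, S η = ∑ v, η v := fun η => by simp [S]
  let T' := T.prod S
  -- There are finitely many sign patterns, hence one constant each and their sum for all. The
  -- constant 1 is a dummy for patterns whose cone meets the kernel nontrivially.
  have hpat : ∀ s : ι → SignType, ∃ c > 0,
      (∀ η ∈ signCone s, T' η = 0 → η = 0) → ∀ η ∈ signCone s, ‖η‖ ≤ c * ‖T' η‖ := by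
    intro s
    by_cases h : ∀ η ∈ signCone s, T' η = 0 → η = 0
    · obtain ⟨c, hc, hb⟩ := exists_norm_le_mul_norm_on_cone T' (isClosed_signCone s)
        (fun a ha x hx v => ⟨by
          have := mul_nonneg ha.le (hx v).1
          simp only [Pi.smul_apply, smul_eq_mul]; linarith, fun h0 => by simp [(hx v).2 h0]⟩) h
      exact ⟨c, hc, fun _ => hb⟩
    · exact ⟨1, one_pos, fun h' => absurd h' h⟩
  choose c hc hb using hpat
  refine ⟨∑ s, c s, Finset.sum_pos (fun s _ => hc s) ⟨fun _ => 0, Finset.mem_univ _⟩, ?_⟩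
  intro w hw z hz
  have hcpt : IsCompact (stdSimplex ℝ ι ∩ T ⁻¹' {T z}) :=
    (isCompact_stdSimplex ℝ ι).inter_right
      (isClosed_singleton.preimage T.continuous_of_finiteDimensional)
  -- `l` is the ℓ¹-nearest point to `w` in the fibre of `T z`. Minimality forbids a nonzero kernel
  -- direction with the sign pattern of `l - w`: subtracting a small multiple of it moves every
  -- coordinate of `l` towards `w`, stays in the simplex, and shortens the distance.
  obtain ⟨l, ⟨hl, hlT⟩, hmin⟩ := hcpt.exists_isMinOn ⟨z, hz, rfl⟩
    (f := fun l => ∑ v, |l v - w v|) (by fun_prop)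
  replace hlT : T l = T z := hlT
  refine ⟨l, hl, hlT, ?_⟩
  set s : ι → SignType := fun v => SignType.sign (l v - w v) with hs
  have hδ : l - w ∈ signCone s := fun v => by
    simp only [hs, Pi.sub_apply, sign_eq_zero_iff, imp_self, and_true]
    rw [sign_mul_self]; exact abs_nonneg _
  have hker : ∀ η ∈ signCone s, T' η = 0 → η = 0 := by
    intro η hη h0
    by_contra hne
    have hT0 : T η = 0 := congrArg Prod.fst h0
    have hS0 : ∑ v, η v = 0 := by rw [← hS]; exact congrArg Prod.snd h0
    have hev : ∀ᶠ t : ℝ in 𝓝[>] 0, ∀ v, t * |η v| ≤ |l v - w v| := by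
      refine eventually_all.2 fun v => ?_
      by_cases hv : l v - w v = 0
      · have : η v = 0 := (hη v).2 (by simp [hs, hv])
        simp [this]
      · have h1 : Tendsto (fun t : ℝ => t * |η v|) (𝓝[>] 0) (𝓝 (0 * |η v|)) :=
          ((continuous_id.mul continuous_const).tendsto 0).mono_left nhdsWithin_le_nhds
        rw [zero_mul] at h1
        exact (h1.eventually (gt_mem_nhds (abs_pos.2 hv))).mono fun t ht => le_of_lt ht
    obtain ⟨t, ht, htpos⟩ := (hev.and self_mem_nhdsWithin).exists
    replace htpos : 0 < t := htpos
    have habs : ∀ v, |l v - t * η v - w v| = |l v - w v| - t * |η v| ∧ 0 ≤ l v - t * η v := by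
      intro v
      have h1 := ht v
      have h2 := hη v
      have h3 : 0 ≤ l v := hl.1 v
      have h4 : 0 ≤ w v := hw.1 v
      rcases lt_trichotomy (l v - w v) 0 with h | h | h
      · have h5 : η v ≤ 0 := by
          have := h2.1; simp only [hs, sign_neg h] at this; simpa using this
        have h6 := mul_nonneg htpos.le (neg_nonneg.2 h5)
        rw [abs_of_neg h, abs_of_nonpos h5] at *
        rw [abs_of_nonpos (by linarith)]
        constructor <;> linarith
      · have h5 : η v = 0 := h2.2 (by simp [hs, h])
        simp [h5, h3]
      · have h5 : 0 ≤ η v := by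
          have := h2.1; simp only [hs, sign_pos h] at this; simpa using this
        have h6 := mul_nonneg htpos.le h5
        rw [abs_of_pos h, abs_of_nonneg h5] at *
        rw [abs_of_nonneg (by linarith)]
        constructor <;> linarith
    have hmem : l - t • η ∈ stdSimplex ℝ ι ∩ T ⁻¹' {T z} := by
      refine ⟨⟨fun v => (habs v).2, ?_⟩, ?_⟩
      · simp [Finset.sum_sub_distrib, ← Finset.mul_sum, hS0, hl.2]
      · simp [hT0, hlT]
    have h1 : ∑ v, |l v - w v| ≤ ∑ v, |l v - t * η v - w v| := hmin hmem
    simp only [fun v => (habs v).1, Finset.sum_sub_distrib, ← Finset.mul_sum] at h1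
    obtain ⟨v, hv⟩ := Function.ne_iff.1 hne
    have h2 : 0 < ∑ v, |η v| := Finset.sum_pos' (fun v _ => abs_nonneg _)
      ⟨v, Finset.mem_univ _, abs_pos.2 hv⟩
    have := mul_pos htpos h2
    linarith
  have h1 := hb s hker (l - w) hδ
  have h2 : ‖T' (l - w)‖ = ‖T z - T w‖ := by
    have : T' (l - w) = (T z - T w, 0) := by
      refine Prod.ext ?_ ?_
      · simp [T', hlT]
      · change S (l - w) = 0
        rw [hS]; simp [Finset.sum_sub_distrib, hl.2, hw.2]
    rw [this, Prod.norm_def]; simp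
  rw [h2] at h1
  exact h1.trans (mul_le_mul_of_nonneg_right
    (Finset.single_le_sum (fun s _ => (hc s).le) (Finset.mem_univ s)) (norm_nonneg _))

/-- The pairwise gap of a linear function dominates its slope between two convex combinations. -/
lemma exists_inner_le_mul_gap {ι X : Type*} [Fintype ι] [NormedAddCommGroup X]
    [InnerProductSpace ℝ X] (a : ι → X) :
    ∃ K > 0, ∀ w ∈ stdSimplex ℝ ι, ∀ z ∈ stdSimplex ℝ ι, ∀ (g : X) (A B : ℝ),
      (∀ v, w v ≠ 0 → inner ℝ g (a v) ≤ A) → (∀ v, B ≤ inner ℝ g (a v)) →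
      inner ℝ g (∑ v, w v • a v - ∑ v, z v • a v) ≤
        K * ‖∑ v, w v • a v - ∑ v, z v • a v‖ * (A - B) := by
  obtain ⟨c, hc, hoff⟩ := exists_stdSimplex_near (Fintype.linearCombination ℝ a)
  simp only [Fintype.linearCombination_apply] at hoff
  -- The `+ 1` only keeps the constant positive for an empty index type.
  refine ⟨(Fintype.card ι + 1) * c, by positivity, fun w hw z hz g A B hA hB => ?_⟩
  obtain ⟨l, hl, hlz, hn⟩ := hoff w hw z hz
  have hAB : 0 ≤ A - B := by
    have : ∃ v, w v ≠ 0 := by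
      by_contra! h
      have := hw.2
      simp [h] at this
    obtain ⟨v, hv⟩ := this
    linarith [hA v hv, hB v]
  rw [← hlz] at hn ⊢
  set D := ‖∑ v, l v • a v - ∑ v, w v • a v‖ with hD
  rw [norm_sub_rev, ← hD]
  -- Since both weights sum to one, `B` may be subtracted from every value. Indices outside the
  -- support of `w`, where `A` gives no control, then contribute nonpositively.
  have hterm : ∀ v, (w v - l v) * (inner ℝ g (a v) - B) ≤ c * D * (A - B) := by
    intro v
    have h1 : |w v - l v| ≤ c * D := by
      rw [abs_sub_comm]
      exact (norm_le_pi_norm (l - w) v).trans hn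
    have h2 := hB v
    by_cases hv : w v = 0
    · have h3 : 0 ≤ l v := hl.1 v
      have h4 : 0 ≤ c * D * (A - B) := by positivity
      have := mul_nonneg h3 (sub_nonneg.2 h2)
      rw [hv]; linarith
    · have h3 := hA v hv
      calc _ ≤ |w v - l v| * (inner ℝ g (a v) - B) :=
            mul_le_mul_of_nonneg_right (le_abs_self _) (by linarith)
        _ ≤ _ := mul_le_mul h1 (by linarith) (by linarith) (by positivity)
  have hsum : inner ℝ g (∑ v, w v • a v - ∑ v, l v • a v)
      = ∑ v, (w v - l v) * (inner ℝ g (a v) - B) := by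
    simp only [mul_sub, sub_mul, Finset.sum_sub_distrib, ← Finset.sum_mul, hw.2, hl.2,
      inner_sub_right, inner_sum, inner_smul_right]
    ring
  rw [hsum]
  calc _ ≤ ∑ _v : ι, c * D * (A - B) := Finset.sum_le_sum fun v _ => hterm v
    _ = Fintype.card ι * (c * D * (A - B)) := by simp
    _ ≤ _ := by
      have : 0 ≤ c * D * (A - B) := by positivity
      linarith

/-! ### Vertices of the polytope and positivity of its constants -/

section Polytope

variable {p c : ℕ} {C : Matrix (Fin c) (Fin p) ℝ} {b : Fin c → ℝ}

lemma convex_polyhedron : Convex ℝ (polyhedron C b) := by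
  intro x hx y hy α β hα hβ hαβ j
  have h1 := mul_le_mul_of_nonneg_left (hx j) hα
  have h2 := mul_le_mul_of_nonneg_left (hy j) hβ
  have h3 : α * b j + β * b j = b j := by rw [← add_mul, hαβ, one_mul]
  simp only [WithLp.ofLp_add, WithLp.ofLp_smul, Matrix.mulVec_add, Matrix.mulVec_smul,
    Pi.add_apply, Pi.smul_apply, smul_eq_mul]
  linarith

lemma vertices_subset : vertices C b ⊆ polyhedron C b := extremePoints_subset

/-- No nonzero direction is orthogonal to all constraints that are active at a vertex. -/
lemma eq_zero_of_active_of_mem_vertices {x d : E p} (hx : x ∈ vertices C b)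
    (hd : ∀ j, (C.mulVec x.ofLp) j = b j → (C.mulVec d.ofLp) j = 0) : d = 0 := by
  have hxP := vertices_subset hx
  have hev : ∀ᶠ t : ℝ in 𝓝[>] 0, ∀ j, t * |(C.mulVec d.ofLp) j| ≤ b j - (C.mulVec x.ofLp) j := by
    refine eventually_all.2 fun j => ?_
    rcases (hxP j).eq_or_lt with h | h
    · simp [hd j h, h]
    · have h1 : Tendsto (fun t : ℝ => t * |(C.mulVec d.ofLp) j|) (𝓝[>] 0)
          (𝓝 (0 * |(C.mulVec d.ofLp) j|)) :=
        ((continuous_id.mul continuous_const).tendsto 0).mono_left nhdsWithin_le_nhds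
      rw [zero_mul] at h1
      exact (h1.eventually (gt_mem_nhds (sub_pos.2 h))).mono fun t ht => le_of_lt ht
  obtain ⟨t, ht, htpos⟩ := (hev.and self_mem_nhdsWithin).exists
  replace htpos : 0 < t := htpos
  have hmem : ∀ r : ℝ, |r| = t → x + r • d ∈ polyhedron C b := by
    intro r hr j
    have h1 := ht j
    rw [← hr, ← abs_mul] at h1
    have h2 := le_abs_self (r * (C.mulVec d.ofLp) j)
    simp only [WithLp.ofLp_add, WithLp.ofLp_smul, Matrix.mulVec_add, Matrix.mulVec_smul,
      Pi.add_apply, Pi.smul_apply, smul_eq_mul]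
    linarith
  have h1 := hmem t (abs_of_pos htpos)
  have h2 := hmem (-t) (by rw [abs_neg, abs_of_pos htpos])
  have h3 : x ∈ openSegment ℝ (x + t • d) (x + (-t) • d) :=
    ⟨1 / 2, 1 / 2, by norm_num, by norm_num, by norm_num, by module⟩
  have h4 := hx.2 h1 h2 h3
  have h5 : t • d = 0 := by simpa using h4
  exact (smul_eq_zero.1 h5).resolve_left htpos.ne'

-- A vertex is determined by its set of active constraints, because the difference of two vertices
-- with the same set is orthogonal to all of these constraints.
variable (C b) in
lemma finite_vertices : (vertices C b).Finite := by
  refine Set.Finite.of_finite_image (f := fun x : E p => {j | (C.mulVec x.ofLp) j = b j})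
    (Set.toFinite _) fun x hx y hy hxy => ?_
  refine sub_eq_zero.1 (eq_zero_of_active_of_mem_vertices (d := x - y) hx fun j hj => ?_)
  have h2 : (C.mulVec y.ofLp) j = b j := (Set.ext_iff.1 hxy j).1 hj
  simp [Matrix.mulVec_sub, hj, h2]

/-- Krein–Milman; the closure is superfluous because the hull of a finite set is closed. -/
lemma convexHull_vertices (hP : IsCompact (polyhedron C b)) :
    convexHull ℝ (vertices C b) = polyhedron C b := by
  rw [← closure_convexHull_extremePoints hP convex_polyhedron]
  exact ((finite_vertices C b).isClosed_convexHull ℝ).closure_eq.symm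

lemma nontrivial_vertices (hP : IsCompact (polyhedron C b)) (hne : (polyhedron C b).Nontrivial) :
    (vertices C b).Nontrivial := by
  by_contra h
  rw [Set.not_nontrivial_iff] at h
  have h1 := convexHull_vertices hP
  rcases h.eq_empty_or_singleton with h2 | ⟨v, h2⟩
  · rw [h2, convexHull_empty] at h1
    exact hne.nonempty.ne_empty h1.symm
  · rw [h2, convexHull_singleton] at h1
    rw [← h1] at hne
    exact Set.not_nontrivial_singleton hne

/-- Otherwise every row would vanish on the difference of two distinct vertices. This makes the sets
defining `zeta` and `phi` nonempty, so that neither takes the default value 0. -/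
lemma exists_notMem_activeAtAllVertices (hP : IsCompact (polyhedron C b))
    (hne : (polyhedron C b).Nontrivial) : ∃ j, j ∉ activeAtAllVertices C b ∧ C j ≠ 0 := by
  by_contra! h
  obtain ⟨x, hx, y, hy, hxy⟩ := nontrivial_vertices hP hne
  refine hxy (sub_eq_zero.1 (eq_zero_of_active_of_mem_vertices (d := x - y) hx fun j _ => ?_))
  by_cases hj : j ∈ activeAtAllVertices C b
  · simp [Matrix.mulVec_sub, hj x hx, hj y hy]
  · simp [Matrix.mulVec, h j hj]

lemma zeta_pos (hP : IsCompact (polyhedron C b)) (hne : (polyhedron C b).Nontrivial) :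
    0 < zeta C b := by
  have hmem : zeta C b ∈ {t | ∃ v ∈ vertices C b, ∃ j,
      (C.mulVec v.ofLp) j < b j ∧ t = b j - (C.mulVec v.ofLp) j} := by
    refine Set.Nonempty.csInf_mem ?_ ?_
    · obtain ⟨j, hj, -⟩ := exists_notMem_activeAtAllVertices hP hne
      simp only [activeAtAllVertices, Set.mem_ofPred_eq, not_forall] at hj
      obtain ⟨v, hv, hvj⟩ := hj
      exact ⟨_, v, hv, j, lt_of_le_of_ne (vertices_subset hv j) hvj, rfl⟩
    · refine (((finite_vertices C b).prod (Set.finite_univ (α := Fin c))).image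
        fun q => b q.2 - (C.mulVec q.1.ofLp) q.2).subset ?_
      rintro t ⟨v, hv, j, -, rfl⟩
      exact ⟨(v, j), ⟨hv, Set.mem_univ _⟩, rfl⟩
  obtain ⟨v, -, j, hj, h⟩ := hmem
  rw [h]
  linarith

lemma phi_pos (hP : IsCompact (polyhedron C b)) (hne : (polyhedron C b).Nontrivial) :
    0 < phi C b := by
  obtain ⟨j, hj, hC⟩ := exists_notMem_activeAtAllVertices hP hne
  refine lt_of_lt_of_le (b := ‖(WithLp.toLp 2 (C j) : E p)‖) (norm_pos_iff.2 fun h => hC ?_)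
    (le_csSup ?_ ⟨j, hj, rfl⟩)
  · exact congrArg WithLp.ofLp h
  · refine ((Set.finite_range fun j => ‖(WithLp.toLp 2 (C j) : E p)‖).subset ?_).bddAbove
    rintro t ⟨j, -, rfl⟩
    exact ⟨j, rfl⟩

lemma vertexBound_pos (hP : IsCompact (polyhedron C b)) (hne : (polyhedron C b).Nontrivial)
    (cara : Bool) : 0 < vertexBound C b cara := by
  unfold vertexBound
  split
  · omega
  · exact (Set.ncard_pos (finite_vertices C b)).2 (nontrivial_vertices hP hne).nonempty

lemma rho_pos {n : ℕ} (hn : 0 < n) (hP : IsCompact (polyhedron C b))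
    (hne : (polyhedron C b).Nontrivial) {σ : Fin n → ℝ} {L : Fin n → ℝ≥0} (hσ : ∀ i, 0 < σ i)
    (hL : ∀ i, 0 < L i) (cara : Bool) : 0 < rho C b σ L cara := by
  have : Nonempty (Fin n) := ⟨⟨0, hn⟩⟩
  have h1 : 0 < ⨅ i, σ i := by
    obtain ⟨i, hi⟩ := exists_eq_ciInf_of_finite (f := σ)
    rw [← hi]; exact hσ i
  have h2 : 0 < ⨆ i, (L i : ℝ) :=
    lt_of_lt_of_le (NNReal.coe_pos.2 (hL ⟨0, hn⟩))
      (le_ciSup (f := fun i => (L i : ℝ)) (Set.finite_range _).bddAbove _)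
  have h3 : 0 < (vertexBound C b cara : ℝ) := Nat.cast_pos.2 (vertexBound_pos hP hne cara)
  have h4 : 0 < Metric.diam (polyhedron C b) := Metric.diam_pos hne hP.isBounded
  have h5 : 0 < Omega C b := div_pos (zeta_pos hP hne) (phi_pos hP hne)
  exact lt_min (by norm_num) (by positivity)

/-- Error bound over the vertices of a polytope: if `x` is a convex combination of vertices, then
the gap between the vertices used by `x` and the best vertex controls the slope towards any
feasible point. -/
lemma exists_inner_le_mul_vertex_gap (hP : IsCompact (polyhedron C b)) :
    ∃ K > 0, ∀ w : E p → ℝ, (∀ v, 0 ≤ w v) →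
      ∑ v ∈ (finite_vertices C b).toFinset, w v = 1 → ∀ y ∈ polyhedron C b, ∀ (g : E p) (A B : ℝ),
      (∀ v, w v ≠ 0 → inner ℝ g v ≤ A) → (∀ v ∈ polyhedron C b, B ≤ inner ℝ g v) →
      inner ℝ g (∑ v ∈ (finite_vertices C b).toFinset, w v • v - y) ≤
        K * ‖∑ v ∈ (finite_vertices C b).toFinset, w v • v - y‖ * (A - B) := by
  obtain ⟨K, hK, h⟩ := exists_inner_le_mul_gap
    (fun v : (finite_vertices C b).toFinset => (v : E p))
  refine ⟨K, hK, fun w hw hw1 y hy g A B hA hB => ?_⟩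
  have hy' : y ∈ convexHull ℝ ((finite_vertices C b).toFinset : Set (E p)) := by
    rw [Set.Finite.coe_toFinset, convexHull_vertices hP]; exact hy
  rw [Finset.mem_convexHull'] at hy'
  obtain ⟨z, hz, hz1, hzy⟩ := hy'
  have := h (fun v => w v) ⟨fun v => hw v, by rw [← hw1]; exact Finset.sum_coe_sort _ w⟩
    (fun v => z v) ⟨fun v => hz v v.2, by rw [← hz1]; exact Finset.sum_coe_sort _ z⟩ g A B
    (fun v => hA v) (fun v => hB v (vertices_subset ((Set.Finite.mem_toFinset _).1 v.2)))
  have e1 : ∑ v : (finite_vertices C b).toFinset, w v • (v : E p) =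
    ∑ v ∈ (finite_vertices C b).toFinset, w v • v := Finset.sum_coe_sort _ fun v => w v • v
  have e2 : ∑ v : (finite_vertices C b).toFinset, z v • (v : E p) = y := by
    rw [← hzy]; exact Finset.sum_coe_sort _ fun v => z v • v
  rwa [e1, e2] at this

end Polytope

/-! ### Quadratic upper and lower bounds -/

section Smooth

variable {X : Type*} [NormedAddCommGroup X] [InnerProductSpace ℝ X] [CompleteSpace X]

lemma hasDerivAt_comp_line {f : X → ℝ} (hf : Differentiable ℝ f) (x d : X) (t : ℝ) :
    HasDerivAt (fun t : ℝ => f (x + t • d)) (inner ℝ (gradient f (x + t • d)) d) t := by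
  have h1 := (hf (x + t • d)).hasGradientAt.hasFDerivAt
  have h2 : HasDerivAt (fun t : ℝ => x + t • d) d t := by
    simpa using ((hasDerivAt_id t).smul_const d).const_add x
  exact h1.comp_hasDerivAt t h2

/-- The descent lemma for functions with Lipschitz gradient. -/
lemma descent_lemma {f : X → ℝ} (hf : Differentiable ℝ f) {L : ℝ≥0}
    (hL : LipschitzWith L (gradient f)) (x d : X) :
    f (x + d) ≤ f x + inner ℝ (gradient f x) d + L / 2 * ‖d‖ ^ 2 := by
  -- Comparing the endpoints of this auxiliary function gives the claim; its derivative on (0, 1) is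
  -- nonpositive by Cauchy–Schwarz and the Lipschitz bound, so nothing needs to be integrated.
  have hder : ∀ t : ℝ, HasDerivAt (fun t : ℝ => f (x + t • d) - t * inner ℝ (gradient f x) d
      - t ^ 2 * (L / 2 * ‖d‖ ^ 2)) (inner ℝ (gradient f (x + t • d)) d
      - inner ℝ (gradient f x) d - 2 * t * (L / 2 * ‖d‖ ^ 2)) t := by
    intro t
    have h1 := hasDerivAt_comp_line hf x d t
    have h2 := (hasDerivAt_id t).mul_const (inner ℝ (gradient f x) d)
    have h3 := (hasDerivAt_pow 2 t).mul_const (L / 2 * ‖d‖ ^ 2)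
    exact ((h1.sub h2).sub h3).congr_deriv (by simp)
  have hanti : AntitoneOn (fun t : ℝ => f (x + t • d) - t * inner ℝ (gradient f x) d
      - t ^ 2 * (L / 2 * ‖d‖ ^ 2)) (Set.Icc 0 1) := by
    refine antitoneOn_of_deriv_nonpos (convex_Icc 0 1)
      (fun t _ => (hder t).continuousAt.continuousWithinAt)
      (fun t _ => (hder t).differentiableAt.differentiableWithinAt) fun t ht => ?_
    rw [interior_Icc] at ht
    rw [(hder t).deriv, ← inner_sub_left]
    have h1 := real_inner_le_norm (gradient f (x + t • d) - gradient f x) d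
    have h2 := hL.dist_le_mul (x + t • d) x
    rw [dist_eq_norm, dist_eq_norm, add_sub_cancel_left, norm_smul, Real.norm_eq_abs,
      abs_of_pos ht.1] at h2
    have h3 := mul_le_mul_of_nonneg_right h2 (norm_nonneg d)
    nlinarith
  have := hanti (Set.left_mem_Icc.2 zero_le_one) (Set.right_mem_Icc.2 zero_le_one) zero_le_one
  simp only [one_smul, zero_smul, add_zero] at this
  linarith

/-- The first-order lower bound for strongly convex functions. -/
lemma StrongConvexOn.add_inner_gradient_le {f : X → ℝ} {m : ℝ}
    (hf : StrongConvexOn Set.univ m f) (hd : Differentiable ℝ f) (x y : X) :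
    f x + inner ℝ (gradient f x) (y - x) + m / 2 * ‖y - x‖ ^ 2 ≤ f y := by
  -- Divide the strong convexity inequality on the segment by `t` and let `t` tend to 0 from the
  -- right.
  have h1 : Tendsto (fun t : ℝ => t⁻¹ • (f (x + t • (y - x)) - f x)) (𝓝[>] 0)
      (𝓝 (inner ℝ (gradient f x) (y - x))) := by
    have := (hasDerivAt_comp_line hd x (y - x) 0).tendsto_slope_zero_right
    simpa using this
  have h2 : Tendsto (fun t : ℝ => f y - f x - (1 - t) * (m / 2 * ‖y - x‖ ^ 2)) (𝓝[>] 0)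
      (𝓝 (f y - f x - (1 - 0) * (m / 2 * ‖y - x‖ ^ 2))) := by
    refine (Continuous.tendsto ?_ 0).mono_left nhdsWithin_le_nhds
    fun_prop
  have h3 := le_of_tendsto_of_tendsto h1 h2 (by
    filter_upwards [Ioo_mem_nhdsGT (zero_lt_one' ℝ)] with t ht
    have h4 := hf.2 (Set.mem_univ x) (Set.mem_univ y) (sub_nonneg.2 ht.2.le) ht.1.le (by ring)
    have h5 : (1 - t) • x + t • y = x + t • (y - x) := by module
    rw [h5, norm_sub_rev x y] at h4
    simp only [smul_eq_mul] at h4 ⊢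
    rw [inv_mul_le_iff₀ ht.1]
    linarith)
  linarith

/-- The two quadratic bounds in a nonzero direction squeeze out m ≤ L. Positivity of the Lipschitz
constants therefore need not be assumed. -/
lemma pos_of_strongConvexOn_of_lipschitzWith_gradient [Nontrivial X] {f : X → ℝ} {m : ℝ}
    {L : ℝ≥0} (hm : 0 < m) (hf : StrongConvexOn Set.univ m f) (hd : Differentiable ℝ f)
    (hL : LipschitzWith L (gradient f)) : 0 < L := by
  obtain ⟨d, hd0⟩ := exists_ne (0 : X)
  have h1 := descent_lemma hd hL 0 d
  have h2 := StrongConvexOn.add_inner_gradient_le hf hd 0 d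
  rw [zero_add] at h1
  rw [sub_zero] at h2
  have h3 : 0 < ‖d‖ ^ 2 := by positivity
  have h4 : m / 2 ≤ L / 2 := le_of_mul_le_mul_right (by linarith) h3
  exact NNReal.coe_pos.1 (by linarith)

end Smooth

/-! ### Averaged bounds for the sampled objective -/

section Sampled

variable {n p m : ℕ} {f : Fin n → E p → ℝ} {L : Fin n → ℝ≥0}

lemma sampledObjective_add_le (hd : ∀ i, Differentiable ℝ (f i))
    (hL : ∀ i, LipschitzWith (L i) (gradient (f i))) (ξ : Fin m → Fin n) (x d : E p) :
    sampledObjective f ξ (x + d) ≤ sampledObjective f ξ x + inner ℝ (sampledGradient f ξ x) d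
      + sampledLipschitz L ξ / 2 * ‖d‖ ^ 2 := by
  simp only [sampledObjective, sampledGradient, sampledLipschitz, inner_smul_left, sum_inner]
  have h : ∑ i, f (ξ i) (x + d) ≤ ∑ i, (f (ξ i) x + inner ℝ (gradient (f (ξ i)) x) d
      + L (ξ i) / 2 * ‖d‖ ^ 2) := Finset.sum_le_sum fun i _ => descent_lemma (hd _) (hL _) x d
  rw [Finset.sum_add_distrib, Finset.sum_add_distrib, ← Finset.sum_mul, ← Finset.sum_div] at h
  have := mul_le_mul_of_nonneg_left h (by positivity : 0 ≤ 1 / (m : ℝ))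
  simp only [conj_trivial]
  linarith

lemma add_inner_le_sampledObjective {τ : ℝ} (hm : 0 < m)
    (hd : ∀ i, Differentiable ℝ (f i)) (hf : ∀ i, StrongConvexOn Set.univ τ (f i))
    (ξ : Fin m → Fin n) (x y : E p) :
    sampledObjective f ξ x + inner ℝ (sampledGradient f ξ x) (y - x) + τ / 2 * ‖y - x‖ ^ 2
      ≤ sampledObjective f ξ y := by
  simp only [sampledObjective, sampledGradient, inner_smul_left, sum_inner]
  have h : ∑ i, (f (ξ i) x + inner ℝ (gradient (f (ξ i)) x) (y - x) + τ / 2 * ‖y - x‖ ^ 2)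
      ≤ ∑ i, f (ξ i) y :=
    Finset.sum_le_sum fun i _ => StrongConvexOn.add_inner_gradient_le (hf _) (hd _) x y
  rw [Finset.sum_add_distrib, Finset.sum_add_distrib, Finset.sum_const, Finset.card_univ,
    Fintype.card_fin, nsmul_eq_mul] at h
  have hm' : (0 : ℝ) < m := Nat.cast_pos.2 hm
  have := mul_le_mul_of_nonneg_left h (by positivity : 0 ≤ 1 / (m : ℝ))
  have e : 1 / (m : ℝ) * (m * (τ / 2 * ‖y - x‖ ^ 2)) = τ / 2 * ‖y - x‖ ^ 2 := by field_simp
  simp only [conj_trivial]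
  linarith

lemma convexOn_sampledObjective (hf : ∀ i, ConvexOn ℝ Set.univ (f i)) (ξ : Fin m → Fin n) :
    ConvexOn ℝ Set.univ (sampledObjective f ξ) := by
  have h : ConvexOn ℝ Set.univ (fun x => ∑ i, f (ξ i) x) := by
    refine ⟨convex_univ, fun x _ y _ α β hα hβ hαβ => ?_⟩
    simp only [Finset.smul_sum, ← Finset.sum_add_distrib]
    exact Finset.sum_le_sum fun i _ => (hf _).2 trivial trivial hα hβ hαβ
  exact h.smul (by positivity : 0 ≤ 1 / (m : ℝ))

lemma sampledLipschitz_pos (hm : 0 < m) (hL : ∀ i, 0 < L i) (ξ : Fin m → Fin n) :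
    0 < sampledLipschitz L ξ := by
  have : Nonempty (Fin m) := ⟨⟨0, hm⟩⟩
  have hm' : (0 : ℝ) < m := Nat.cast_pos.2 hm
  exact mul_pos (by positivity) (Finset.sum_pos (fun i _ => NNReal.coe_pos.2 (hL _))
    Finset.univ_nonempty)

lemma sampledLipschitz_le {M : ℝ} (hm : 0 < m) (hL : ∀ i, (L i : ℝ) ≤ M) (ξ : Fin m → Fin n) :
    sampledLipschitz L ξ ≤ M := by
  have hm' : (0 : ℝ) < m := Nat.cast_pos.2 hm
  unfold sampledLipschitz
  rw [one_div, inv_mul_le_iff₀ hm']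
  calc _ ≤ ∑ _i : Fin m, M := Finset.sum_le_sum fun i _ => hL _
    _ = m * M := by simp

end Sampled

/-! ### Vertex representations and their updates -/

section Representation

variable {p : ℕ}

/-- The weights of the state are convex weights of its point over the vertex set `V`, carried by
the active set. -/
structure IsVertexRepresentation (V : Finset (E p)) (s : State p) : Prop where
  subset : s.U ⊆ V
  nonneg : ∀ v, 0 ≤ s.w v
  eq_zero : ∀ v, v ∉ s.U → s.w v = 0
  sum_weights : ∑ v ∈ V, s.w v = 1
  sum_smul : ∑ v ∈ V, s.w v • v = s.x

namespace IsVertexRepresentation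

variable {V : Finset (E p)} {s t : State p}

lemma initialState {v : E p} (hv : v ∈ V) : IsVertexRepresentation V (initialState v) := by
  classical
  refine ⟨by simpa [ASFW.initialState] using hv, fun y => ?_, fun y hy => ?_, ?_, ?_⟩
  · simp only [ASFW.initialState]; split <;> norm_num
  · simpa [ASFW.initialState] using hy
  · simp [ASFW.initialState, hv]
  · simp [ASFW.initialState, hv, ite_smul]

lemma weight_le_one (h : IsVertexRepresentation V s) {v : E p} (hv : v ∈ V) : s.w v ≤ 1 := by
  rw [← h.sum_weights]
  exact Finset.single_le_sum (fun v _ => h.nonneg v) hv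

lemma weight_eq_zero_of_weight_eq_one (h : IsVertexRepresentation V s) {u v : E p} (hu : u ∈ V)
    (h1 : s.w u = 1) (hvu : v ≠ u) : s.w v = 0 := by
  classical
  by_cases hv : v ∈ V
  · have h2 : s.w u + s.w v ≤ ∑ v ∈ V, s.w v := by
      rw [← Finset.sum_pair hvu.symm]
      exact Finset.sum_le_sum_of_subset_of_nonneg
        (Finset.insert_subset hu (Finset.singleton_subset_iff.2 hv)) fun v _ _ => h.nonneg v
    rw [h.sum_weights] at h2
    linarith [h.nonneg v]
  · exact h.eq_zero v fun h' => hv (h.subset h')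

lemma eq_of_weight_eq_one (h : IsVertexRepresentation V s) {u : E p} (hu : u ∈ V)
    (h1 : s.w u = 1) : s.x = u := by
  rw [← h.sum_smul, Finset.sum_eq_single_of_mem u hu fun v _ hvu => ?_, h1, one_smul]
  rw [h.weight_eq_zero_of_weight_eq_one hu h1 hvu, zero_smul]

lemma fwUpdate (h : IsVertexRepresentation V s) {q : E p} (hq : q ∈ V) {γ : ℝ} (h0 : 0 ≤ γ)
    (h1 : γ ≤ 1) : IsVertexRepresentation V (fwUpdate s q γ) := by
  classical
  have hw : ∀ v, (ASFW.fwUpdate s q γ).w v = (1 - γ) * s.w v + if v = q then γ else 0 := by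
    intro v
    simp only [ASFW.fwUpdate]
    split_ifs with hv
    · rw [hv]; ring
    · ring
  have hnn : ∀ v, 0 ≤ (ASFW.fwUpdate s q γ).w v := fun v => by
    rw [hw]
    have := mul_nonneg (sub_nonneg.2 h1) (h.nonneg v)
    split_ifs <;> linarith
  have hsum : ∑ v ∈ V, (ASFW.fwUpdate s q γ).w v = 1 := by
    simp [hw, Finset.sum_add_distrib, ← Finset.mul_sum, h.sum_weights, hq]
  refine ⟨?_, hnn, fun v hv => ?_, hsum, ?_⟩
  · simp only [ASFW.fwUpdate]
    split_ifs
    · simpa using hq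
    · exact Finset.insert_subset hq h.subset
  · by_cases hone : s.w q * (1 - γ) + γ = 1
    · have hvq : v ≠ q := by simpa [ASFW.fwUpdate, hone] using hv
      -- Resetting the active set to `{q}` loses no weight: either the step is full, or all mass was
      -- already at `q`.
      have hz : (1 - γ) * (1 - s.w q) = 0 := by linarith
      rw [hw, if_neg hvq, add_zero]
      rcases mul_eq_zero.1 hz with h2 | h2
      · rw [h2, zero_mul]
      · rw [h.weight_eq_zero_of_weight_eq_one hq (by linarith) hvq, mul_zero]
    · have hv' : v ≠ q ∧ v ∉ s.U := by simpa [ASFW.fwUpdate, hone] using hv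
      rw [hw, if_neg hv'.1, h.eq_zero v hv'.2]; simp
  · change _ = s.x + γ • (q - s.x)
    simp only [hw, add_smul, mul_smul, Finset.sum_add_distrib, ← Finset.smul_sum, h.sum_smul,
      ite_smul, zero_smul, Finset.sum_ite_eq', hq, if_true]
    module

lemma awayUpdate (h : IsVertexRepresentation V s) {u : E p} (hu : u ∈ V) {γ : ℝ} (h0 : 0 ≤ γ)
    (h1 : s.w u < 1) (h2 : γ ≤ s.w u / (1 - s.w u)) :
    IsVertexRepresentation V (awayUpdate s u γ) := by
  classical
  have hw : ∀ v, (ASFW.awayUpdate s u γ).w v = (1 + γ) * s.w v - if v = u then γ else 0 := by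
    intro v
    simp only [ASFW.awayUpdate]
    split_ifs with hv
    · rw [hv]; ring
    · ring
  -- With the denominator cleared, the step bound is exactly nonnegativity of the new weight of `u`.
  rw [le_div_iff₀ (by linarith)] at h2
  refine ⟨?_, fun v => ?_, fun v hv => ?_, ?_, ?_⟩
  · simp only [ASFW.awayUpdate]
    split_ifs
    · exact (Finset.erase_subset _ _).trans h.subset
    · exact h.subset
  · rw [hw]
    have := mul_nonneg (by linarith : 0 ≤ 1 + γ) (h.nonneg v)
    split_ifs with hv
    · rw [hv]; linarith
    · linarith
  · by_cases hzero : s.w u * (1 + γ) - γ = 0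
    · rw [hw]
      by_cases hvu : v = u
      · rw [if_pos hvu, hvu]; linarith
      · have hvU : v ∉ s.U := by
          simp only [ASFW.awayUpdate, hzero, if_true, Finset.mem_erase] at hv
          exact fun h' => hv ⟨hvu, h'⟩
        rw [if_neg hvu, h.eq_zero v hvU]; simp
    · have hvU : v ∉ s.U := by simpa [ASFW.awayUpdate, hzero] using hv
      rw [hw, h.eq_zero v hvU]
      by_cases hvu : v = u
      · have h3 : s.w u = 0 := hvu ▸ h.eq_zero v hvU
        rw [h3] at h2
        rw [if_pos hvu]; linarith
      · rw [if_neg hvu]; simp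
  · simp [hw, Finset.sum_sub_distrib, ← Finset.mul_sum, h.sum_weights, hu]
  · change _ = s.x + γ • (s.x - u)
    simp only [hw, sub_smul, mul_smul, Finset.sum_sub_distrib, ← Finset.smul_sum, h.sum_smul,
      ite_smul, zero_smul, Finset.sum_ite_eq', hu, if_true]
    module

lemma caratheodoryReduction (h : IsVertexRepresentation V s) (ht : IsCaratheodoryReduction s t) :
    IsVertexRepresentation V t := by
  obtain ⟨-, hU, -, hnn, hz, hsum, hx⟩ := ht
  have hUV := hU.trans h.subset
  refine ⟨hUV, fun v => ?_, hz, ?_, ?_⟩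
  · by_cases hv : v ∈ t.U
    · exact hnn v hv
    · exact (hz v hv).ge
  · rw [← hsum, Finset.sum_subset hUV fun v _ hv => hz v hv]
  · rw [← hx, Finset.sum_subset hUV fun v _ hv => by rw [hz v hv, zero_smul]]

end IsVertexRepresentation

lemma card_fwUpdate_le (s : State p) (q : E p) (γ : ℝ) :
    (fwUpdate s q γ).U.card ≤ s.U.card + 1 := by
  classical
  simp only [fwUpdate]
  split_ifs
  · simp
  · exact Finset.card_insert_le _ _

lemma card_awayUpdate_le (s : State p) (u : E p) (γ : ℝ) :
    (awayUpdate s u γ).U.card ≤ s.U.card := by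
  classical
  simp only [awayUpdate]
  split_ifs
  · exact Finset.card_le_card (Finset.erase_subset _ _)
  · rfl

/-- The maximal step is the one that annihilates the weight of `u`. This includes an active vertex
of weight 0, where the step has length 0 and still drops `u`. -/
lemma card_awayUpdate_drop {s : State p} {u : E p} (hu : u ∈ s.U) (h1 : s.w u < 1) :
    (awayUpdate s u (s.w u / (1 - s.w u))).U.card + 1 = s.U.card := by
  classical
  have h2 : s.w u * (1 + s.w u / (1 - s.w u)) - s.w u / (1 - s.w u) = 0 := by
    have : 1 - s.w u ≠ 0 := by linarith
    field_simp
    ring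
  simp only [awayUpdate, h2, if_true]
  exact Finset.card_erase_add_one hu

end Representation

/-! ### Progress of a single iteration -/

section Step

/-- A step length chosen by the short-step rule or by exact line search is at least as good as the
short step, and as good as the unconstrained short step unless it is maximal. -/
lemma step_length_spec {φ : ℝ → ℝ} (hφ : ConvexOn ℝ Set.univ φ) {τ γmax γ : ℝ} (hτ : 0 ≤ τ)
    (hmax : 0 ≤ γmax)
    (hγ : γ = min τ γmax ∨ (γ ∈ Set.Icc 0 γmax ∧ IsMinOn φ (Set.Icc 0 γmax) γ)) :
    0 ≤ γ ∧ γ ≤ γmax ∧ φ γ ≤ φ (min τ γmax) ∧ (γ = γmax ∨ φ γ ≤ φ τ) := by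
  rcases hγ with rfl | ⟨hmem, hmin⟩
  · refine ⟨le_min hτ hmax, min_le_right _ _, le_rfl, ?_⟩
    rcases le_total τ γmax with h | h
    · right; rw [min_eq_left h]
    · left; rw [min_eq_right h]
  · refine ⟨hmem.1, hmem.2, hmin ⟨le_min hτ hmax, min_le_right _ _⟩, ?_⟩
    rcases hmem.2.eq_or_lt with h | h
    · exact Or.inl h
    right
    rcases le_or_gt τ γmax with h2 | h2
    · exact hmin ⟨hτ, h2⟩
    -- The short step overshoots the interval, but the minimizer lies strictly before its right end;
    -- by convexity `φ` does not fall below `φ γmax` further to the right.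
    · have h3 : φ γ ≤ φ γmax := hmin ⟨hmax, le_rfl⟩
      refine h3.trans (hφ.le_right_of_left_le (Set.mem_univ _) (Set.mem_univ _) ?_ h3)
      rw [openSegment_eq_Ioo (h.trans h2)]
      exact ⟨h, h2⟩

variable {n p c m : ℕ} {C : Matrix (Fin c) (Fin p) ℝ} {b : Fin c → ℝ}
  {f : Fin n → E p → ℝ} {L : Fin n → ℝ≥0}

/-- Effect of one iteration on the sampled objective `G`: either the gap of `G` to a given feasible
point contracts by the factor `1 - β` while the active set gains at most one vertex, or the active
set loses a vertex while `G` does not increase. -/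
lemma IsIteration.progress (hm : 0 < m) (hd : ∀ i, Differentiable ℝ (f i))
    (hL : ∀ i, LipschitzWith (L i) (gradient (f i))) {τ : ℝ} (hτ : 0 < τ)
    (hf : ∀ i, StrongConvexOn Set.univ τ (f i)) (hLpos : ∀ i, 0 < L i) {M : ℝ}
    (hM : ∀ i, (L i : ℝ) ≤ M) {D : ℝ}
    (hD : ∀ x ∈ polyhedron C b, ∀ y ∈ polyhedron C b, ‖x - y‖ ≤ D) {K : ℝ} (hK : 0 < K)
    (hgap : ∀ w : E p → ℝ, (∀ v, 0 ≤ w v) →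
      ∑ v ∈ (finite_vertices C b).toFinset, w v = 1 → ∀ y ∈ polyhedron C b, ∀ (g : E p) (A B : ℝ),
      (∀ v, w v ≠ 0 → inner ℝ g v ≤ A) → (∀ v ∈ polyhedron C b, B ≤ inner ℝ g v) →
      inner ℝ g (∑ v ∈ (finite_vertices C b).toFinset, w v • v - y) ≤
        K * ‖∑ v ∈ (finite_vertices C b).toFinset, w v • v - y‖ * (A - B))
    {β : ℝ} (hβ0 : 0 ≤ β) (hβ : β ≤ 1 / 2) (hβ' : β * (4 * K ^ 2 * M * D ^ 2) ≤ τ)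
    {cara : Bool} {ξ : Fin m → Fin n} {s s' : State p}
    (hs : IsVertexRepresentation (finite_vertices C b).toFinset s)
    (hit : IsIteration C b f L cara ξ s s') :
    IsVertexRepresentation (finite_vertices C b).toFinset s' ∧
      sampledObjective f ξ s'.x ≤ sampledObjective f ξ s.x ∧
      ∀ y ∈ polyhedron C b, sampledObjective f ξ y ≤ sampledObjective f ξ s.x →
        (sampledObjective f ξ s'.x - sampledObjective f ξ y ≤
            (1 - β) * (sampledObjective f ξ s.x - sampledObjective f ξ y) ∧
          s'.U.card ≤ s.U.card + 1) ∨ s'.U.card + 1 ≤ s.U.card := by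
  set G := sampledObjective f ξ with hG
  obtain ⟨q, u, γ, t, ⟨hq, hqmin⟩, ⟨hu, humax⟩, hstep, hcara⟩ := hit
  set g := sampledGradient f ξ s.x with hg
  set ℓ := sampledLipschitz L ξ with hℓ
  have hred : (IsVertexRepresentation (finite_vertices C b).toFinset t →
      IsVertexRepresentation (finite_vertices C b).toFinset s') ∧ s'.x = t.x ∧
      s'.U.card ≤ t.U.card := by
    cases cara
    · have : s' = t := by simpa using hcara
      subst this
      exact ⟨id, rfl, le_rfl⟩
    · have h : IsCaratheodoryReduction t s' := by simpa using hcara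
      exact ⟨fun ht => ht.caratheodoryReduction h, h.1, Finset.card_le_card h.2.1⟩
  obtain ⟨hrep, hx', hcard⟩ := hred
  rw [hx']
  suffices hmain : IsVertexRepresentation (finite_vertices C b).toFinset t ∧ G t.x ≤ G s.x ∧
      ∀ y ∈ polyhedron C b, G y ≤ G s.x → (G t.x - G y ≤ (1 - β) * (G s.x - G y) ∧
          t.U.card ≤ s.U.card + 1) ∨ t.U.card + 1 ≤ s.U.card by
    refine ⟨hrep hmain.1, hmain.2.1, fun y hy hyx => ?_⟩
    rcases hmain.2.2 y hy hyx with h | h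
    · exact Or.inl ⟨h.1, hcard.trans h.2⟩
    · exact Or.inr (by omega)
  have hqV : q ∈ (finite_vertices C b).toFinset := (Set.Finite.mem_toFinset _).2 hq
  have huV := hs.subset hu
  have hVP : ∀ v ∈ (finite_vertices C b).toFinset, v ∈ polyhedron C b := fun v hv =>
    vertices_subset ((Set.Finite.mem_toFinset _).1 hv)
  have hxP : s.x ∈ polyhedron C b := by
    rw [← hs.sum_smul]
    exact convex_polyhedron.sum_mem (fun v _ => hs.nonneg v) hs.sum_weights hVP
  have hqmin' : ∀ y ∈ polyhedron C b, inner ℝ g q ≤ inner ℝ g y := fun y hy => hqmin hy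
  have hsupp : ∀ v, s.w v ≠ 0 → inner ℝ g v ≤ inner ℝ g u := fun v hv =>
    humax (by by_contra h'; exact hv (hs.eq_zero v h'))
  set W := inner ℝ g u - inner ℝ g q with hW
  have hW0 : 0 ≤ W := sub_nonneg.2 (hqmin' u (hVP u huV))
  have hℓ0 : 0 < ℓ := sampledLipschitz_pos hm hLpos ξ
  have hℓM : ℓ ≤ M := sampledLipschitz_le hm hM ξ
  have hGconv : ConvexOn ℝ Set.univ G :=
    convexOn_sampledObjective (fun i => ((hf i).strictConvexOn hτ).convexOn) ξ
  -- strong convexity and the error bound over the vertices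
  have hslope : ∀ y ∈ polyhedron C b, G s.x - G y ≤ inner ℝ g (s.x - y) := by
    intro y hy
    have h1 := add_inner_le_sampledObjective hm hd hf ξ s.x y
    rw [← hG, ← hg, ← neg_sub s.x y, inner_neg_right] at h1
    have : 0 ≤ τ / 2 * ‖-(s.x - y)‖ ^ 2 := by positivity
    linarith
  have hpl : ∀ y ∈ polyhedron C b, 2 * τ * (G s.x - G y) ≤ K ^ 2 * W ^ 2 := by
    intro y hy
    have h1 := add_inner_le_sampledObjective hm hd hf ξ s.x y
    rw [← hG, ← hg, ← neg_sub s.x y, inner_neg_right, norm_neg] at h1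
    have h2 := hgap s.w hs.nonneg hs.sum_weights y hy g _ _ hsupp hqmin'
    rw [hs.sum_smul, ← hW] at h2
    -- Completing the square eliminates the unknown distance `‖s.x - y‖`.
    have h3 : G s.x - G y + τ / 2 * ‖s.x - y‖ ^ 2 ≤ K * ‖s.x - y‖ * W := by linarith
    have h4 := mul_le_mul_of_nonneg_left h3 hτ.le
    nlinarith [sq_nonneg (τ * ‖s.x - y‖ - K * W)]
  -- the one-dimensional restriction along the step direction
  have hline : ∀ d : E p, ConvexOn ℝ Set.univ (fun t : ℝ => G (s.x + t • d)) := fun d => by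
    refine ⟨convex_univ, fun x _ y _ α β hα hβ hαβ => ?_⟩
    have h1 : s.x + (α • x + β • y) • d = α • (s.x + x • d) + β • (s.x + y • d) := by
      have h2 : s.x = (α + β) • s.x := by rw [hαβ, one_smul]
      nth_rewrite 1 [h2]
      module
    simp only [h1]
    exact hGconv.2 trivial trivial hα hβ hαβ
  have hdesc : ∀ (d : E p) (t : ℝ), G (s.x + t • d) ≤
      G s.x - t * (-inner ℝ g d) + t ^ 2 * (ℓ * ‖d‖ ^ 2) / 2 := fun d t => by
    have := sampledObjective_add_le hd hL ξ s.x (t • d)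
    rw [← hG, ← hg, ← hℓ, inner_smul_right, norm_smul, mul_pow, Real.norm_eq_abs, sq_abs] at this
    linarith
  -- With slope a ≥ W/2, the unconstrained short step gains a²/(2ℓ‖d‖²) ≥ W²/(8MD²) ≥
  -- τ·gap/(4K²MD²), which is at least β·gap by the condition on `β`.
  have hshort : ∀ (d : E p), 0 < ℓ * ‖d‖ ^ 2 → ‖d‖ ≤ D → 0 ≤ -inner ℝ g d →
      W ≤ 2 * (-inner ℝ g d) → ∀ y ∈ polyhedron C b, G y ≤ G s.x →
      G (s.x + (-inner ℝ g d / (ℓ * ‖d‖ ^ 2)) • d) - G y ≤ (1 - β) * (G s.x - G y) := by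
    intro d hB hdD ha hWa y hy hyx
    have h1 := hdesc d (-inner ℝ g d / (ℓ * ‖d‖ ^ 2))
    set a := -inner ℝ g d
    set B := ℓ * ‖d‖ ^ 2
    have h2 : a / B * a - (a / B) ^ 2 * B / 2 = a ^ 2 / (2 * B) := by field_simp; ring
    have h3 : β * (G s.x - G y) ≤ a ^ 2 / (2 * B) := by
      rw [le_div_iff₀ (by positivity)]
      set h := G s.x - G y with hh
      have hh0 : 0 ≤ h := sub_nonneg.2 hyx
      have hBD : B ≤ M * D ^ 2 := mul_le_mul hℓM (pow_le_pow_left₀ (norm_nonneg _) hdD 2)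
        (by positivity) (hℓ0.le.trans hℓM)
      have h4 : β * h * B ≤ β * h * (M * D ^ 2) :=
        mul_le_mul_of_nonneg_left hBD (mul_nonneg hβ0 hh0)
      have h5 : β * (4 * K ^ 2 * M * D ^ 2) * h ≤ τ * h := mul_le_mul_of_nonneg_right hβ' hh0
      have h6 := hpl y hy
      have h7 : K ^ 2 * (8 * (β * h * (M * D ^ 2))) ≤ K ^ 2 * W ^ 2 := by linarith
      have h8 := le_of_mul_le_mul_left h7 (by positivity)
      have h9 : W ^ 2 ≤ (2 * a) ^ 2 := pow_le_pow_left₀ hW0 hWa 2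
      linarith
    linarith
  rcases hstep with ⟨hcond, hγ, rfl⟩ | ⟨hcond, hγ, rfl⟩
  · -- Frank-Wolfe step
    have ha : 0 ≤ -inner ℝ g (q - s.x) := by
      rw [inner_sub_right]; linarith [hqmin' s.x hxP]
    -- W is the sum of the Frank–Wolfe slope and the away slope; the rule picks the larger of the
    -- two.
    have hWa : W ≤ 2 * (-inner ℝ g (q - s.x)) := by
      simp only [inner_sub_right, inner_add_right, inner_smul_right] at hcond ⊢
      linarith
    obtain ⟨h0, h1, hle, hor⟩ := step_length_spec (hline (q - s.x)) (div_nonneg ha (by positivity))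
      zero_le_one hγ
    have hle0 : ∀ y ∈ polyhedron C b, G y ≤ G s.x →
        G (s.x + γ • (q - s.x)) - G y ≤ (1 - β) * (G s.x - G y) := by
      intro y hy hyx
      by_cases hd0 : q - s.x = 0
      -- A zero direction forces W = 0, so the current point already minimizes the sampled objective
      -- over the polytope.
      · have hW' : W = 0 := by rw [hd0, inner_zero_right] at hWa; linarith
        have := hpl y hy
        rw [hW'] at this
        have h2 : G s.x - G y ≤ 0 := by
          by_contra! h3
          have := mul_pos (mul_pos two_pos hτ) h3
          linarith
        have h3 : G s.x = G y := by linarith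
        simp [hd0, h3]
      · have hB : 0 < ℓ * ‖q - s.x‖ ^ 2 := by positivity
        rcases le_total (-inner ℝ g (q - s.x) / (ℓ * ‖q - s.x‖ ^ 2)) 1 with h2 | h2
        · rw [min_eq_left h2] at hle
          have := hshort _ hB (hD q (hVP q hqV) _ hxP) ha hWa y hy hyx
          linarith
        -- Here the short step is truncated to a full step. It gains at least half the slope, which
        -- is at least half the gap, and β ≤ 1/2 suffices.
        · rw [min_eq_right h2] at hle
          rw [le_div_iff₀ hB] at h2
          have h3 := hdesc (q - s.x) 1
          have h4 := hslope y hy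
          have h5 := hqmin' y hy
          have h6 := mul_le_mul_of_nonneg_right hβ (sub_nonneg.2 hyx)
          simp only [inner_sub_right] at h2 h3 h4
          linarith
    refine ⟨hs.fwUpdate hqV h0 h1, ?_, fun y hy hyx => Or.inl ⟨hle0 y hy hyx,
      card_fwUpdate_le s q γ⟩⟩
    have := hle0 s.x hxP le_rfl
    simp only [sub_self, mul_zero] at this
    change G (s.x + γ • (q - s.x)) ≤ G s.x
    linarith
  · -- away step
    have hqx := hqmin' s.x hxP
    have ha : 0 < -inner ℝ g (s.x - u) := by
      simp only [inner_sub_right, inner_add_right, inner_smul_right] at hcond ⊢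
      linarith
    have hWa : W ≤ 2 * (-inner ℝ g (s.x - u)) := by
      simp only [inner_sub_right, inner_add_right, inner_smul_right] at hcond ⊢
      linarith
    have hd0 : s.x - u ≠ 0 := fun h => by
      rw [h, inner_zero_right] at ha; simp at ha
    have hwu : s.w u < 1 := lt_of_le_of_ne (hs.weight_le_one huV) fun h =>
      hd0 (sub_eq_zero.2 (hs.eq_of_weight_eq_one huV h))
    have hmax : 0 ≤ s.w u / (1 - s.w u) := div_nonneg (hs.nonneg u) (by linarith)
    have hB : 0 < ℓ * ‖s.x - u‖ ^ 2 := by positivity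
    obtain ⟨h0, h1, hle, hor⟩ := step_length_spec (hline (s.x - u)) (div_nonneg ha.le hB.le)
      hmax hγ
    have hmono : G (s.x + γ • (s.x - u)) ≤ G s.x := by
      refine hle.trans ((hdesc _ _).trans ?_)
      set r := min (-inner ℝ g (s.x - u) / (ℓ * ‖s.x - u‖ ^ 2)) (s.w u / (1 - s.w u)) with hr
      have hr0 : 0 ≤ r := le_min (div_nonneg ha.le hB.le) hmax
      have hr1 : r * (ℓ * ‖s.x - u‖ ^ 2) ≤ -inner ℝ g (s.x - u) :=
        (le_div_iff₀ hB).1 (min_le_left _ _)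
      have h2 := mul_le_mul_of_nonneg_left hr1 hr0
      have h3 := mul_nonneg hr0 ha.le
      linarith
    refine ⟨hs.awayUpdate huV h0 hwu h1, hmono, fun y hy hyx => ?_⟩
    -- A maximal away step drops `u` and needs no quantitative decrease; otherwise the step is as
    -- good as the unconstrained short step.
    rcases hor with h | h
    · right
      rw [h]
      exact (card_awayUpdate_drop hu hwu).le
    · left
      refine ⟨?_, (card_awayUpdate_le s u γ).trans (Nat.le_succ _)⟩
      have := hshort _ hB (hD _ hxP u (hVP u huV)) ha.le hWa y hy hyx
      change G (s.x + γ • (s.x - u)) - G y ≤ _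
      linarith

end Step

/-! ### Sampling error -/

section Sampling

variable {n p m : ℕ}

/-- The `ℓ¹` distance between the empirical distribution of a batch and the uniform distribution. -/
noncomputable def freqDeviation (ξ : Fin m → Fin n) : ℝ :=
  ∑ a, |(1 / (m : ℝ)) * ∑ i, (if ξ i = a then 1 else 0) - 1 / (n : ℝ)|

/-- The sampled objective is uniformly close to the objective. -/
lemma abs_sampledObjective_sub_objective_le {f : Fin n → E p → ℝ} {x : E p} {B : ℝ}
    (hB : ∀ a, |f a x| ≤ B) (ξ : Fin m → Fin n) :
    |sampledObjective f ξ x - objective f x| ≤ B * freqDeviation ξ := by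
  have h1 : ∑ i, f (ξ i) x = ∑ a, (∑ i, (if ξ i = a then (1 : ℝ) else 0)) * f a x := by
    simp only [Finset.sum_mul]
    rw [Finset.sum_comm]
    simp
  have h2 : sampledObjective f ξ x - objective f x =
      ∑ a, ((1 / (m : ℝ)) * ∑ i, (if ξ i = a then 1 else 0) - 1 / (n : ℝ)) * f a x := by
    simp only [sampledObjective, objective, h1, sub_mul, Finset.sum_sub_distrib, mul_assoc,
      ← Finset.mul_sum]
  rw [h2, freqDeviation, Finset.mul_sum]
  refine (Finset.abs_sum_le_sum_abs _ _).trans (Finset.sum_le_sum fun a _ => ?_)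
  rw [abs_mul, mul_comm]
  exact mul_le_mul_of_nonneg_right (hB a) (abs_nonneg _)

variable {Ω : Type*} [MeasurableSpace Ω] {μ : Measure Ω} [IsProbabilityMeasure μ]

lemma integrable_comp_of_finite {α : Type*} [Finite α] [MeasurableSpace α]
    [MeasurableSingletonClass α] (h : α → ℝ) {X : Ω → α} (hX : Measurable X) :
    Integrable (fun ω => h (X ω)) μ := by
  have : IsProbabilityMeasure (μ.map X) := Measure.isProbabilityMeasure_map hX.aemeasurable
  exact (Integrable.of_finite (f := h) (μ := μ.map X)).comp_measurable hX

lemma integrable_freqDeviation {ξ : Fin m → Ω → Fin n} (hξ : ∀ i, Measurable (ξ i)) :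
    Integrable (fun ω => freqDeviation fun i => ξ i ω) μ :=
  integrable_comp_of_finite freqDeviation (measurable_pi_lambda _ hξ)

/-- The expected deviation of the empirical distribution of `m` independent uniform samples is of
order `1 / √m`. -/
lemma integral_freqDeviation_le (hm : 0 < m) {ξ : Fin m → Ω → Fin n}
    (hξ : ∀ i, Measurable (ξ i)) (hunif : ∀ i a, μ {ω | ξ i ω = a} = (n : ℝ≥0∞)⁻¹)
    (hindep : Pairwise fun i j => IndepFun (ξ i) (ξ j) μ) :
    ∫ ω, freqDeviation (fun i => ξ i ω) ∂μ ≤ n * (1 / √m) := by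
  have hm' : (0 : ℝ) < m := Nat.cast_pos.2 hm
  have hsq : 0 < √(m : ℝ) := Real.sqrt_pos.2 hm'
  have hξ' : Measurable fun ω i => ξ i ω := measurable_pi_lambda _ hξ
  have hint : ∀ h : (Fin m → Fin n) → ℝ, Integrable (fun ω => h fun i => ξ i ω) μ :=
    fun h => integrable_comp_of_finite h hξ'
  have key : ∀ a, ∫ ω, |(1 / (m : ℝ)) * ∑ i, (if ξ i ω = a then 1 else 0) - 1 / (n : ℝ)| ∂μ
      ≤ 1 / √m := by
    intro a
    let Y : Fin m → Ω → ℝ := fun i ω => if ξ i ω = a then 1 else 0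
    have hY : ∀ i, Measurable (Y i) := fun i =>
      (measurable_of_countable (fun b : Fin n => if b = a then (1 : ℝ) else 0)).comp (hξ i)
    have hYL : ∀ i, MemLp (Y i) 2 μ := fun i =>
      MemLp.of_bound (hY i).aestronglyMeasurable 1 (ae_of_all _ fun ω => by
        simp only [Y]; split_ifs <;> simp)
    have hEY : ∀ i, ∫ ω, Y i ω ∂μ = 1 / n := fun i => by
      have h1 : Y i = Set.indicator {ω | ξ i ω = a} 1 := by
        ext ω; simp [Y, Set.indicator_apply]
      have h2 : MeasurableSet {ω | ξ i ω = a} := hξ i (measurableSet_singleton a)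
      rw [h1, integral_indicator_one h2]
      simp [Measure.real, hunif]
    have hVY : ∀ i, variance (Y i) μ ≤ 1 := fun i => by
      refine (variance_le_expectation_sq (hY i).aestronglyMeasurable).trans ?_
      calc ∫ ω, (Y i ^ 2) ω ∂μ ≤ ∫ _ω, (1 : ℝ) ∂μ :=
            integral_mono ((hYL i).integrable_sq) (integrable_const 1) fun ω => by
              simp only [Y, Pi.pow_apply]; split_ifs <;> simp
        _ = 1 := by simp
    have hV : variance (∑ i, Y i) μ ≤ m := by
      rw [IndepFun.variance_sum (fun i _ => hYL i) fun i _ j _ hij => (hindep hij).comp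
        (measurable_of_countable (fun b : Fin n => if b = a then (1 : ℝ) else 0))
        (measurable_of_countable (fun b : Fin n => if b = a then (1 : ℝ) else 0))]
      calc _ ≤ ∑ _i : Fin m, (1 : ℝ) := Finset.sum_le_sum fun i _ => hVY i
        _ = m := by simp
    have hE : ∫ ω, (∑ i, Y i) ω ∂μ = m / n := by
      simp only [Finset.sum_apply]
      rw [integral_finsetSum _ fun i _ => (hYL i).integrable one_le_two]
      simp [hEY, div_eq_mul_inv]
    have hYsum : Measurable (∑ i, Y i) := by
      rw [Finset.sum_fn]
      exact Finset.measurable_sum _ fun i _ => hY i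
    rw [variance_eq_integral hYsum.aemeasurable, hE] at hV
    -- Arithmetic–geometric mean inequality with weights tuned to a variance of at most m; it
    -- replaces Cauchy–Schwarz in passing from the second moment to the first.
    have hpt : ∀ ω, |(1 / (m : ℝ)) * ∑ i, (if ξ i ω = a then 1 else 0) - 1 / (n : ℝ)| ≤
        (1 / (2 * m * √m)) * ((∑ i, Y i) ω - m / n) ^ 2 + 1 / (2 * √m) := by
      intro ω
      have h1 : (1 / (m : ℝ)) * ∑ i, (if ξ i ω = a then 1 else 0) - 1 / (n : ℝ) =
          ((∑ i, Y i) ω - m / n) / m := by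
        simp only [Finset.sum_apply, Y]
        rw [sub_div, div_div_cancel_left' hm'.ne']
        ring
      rw [h1]
      generalize (∑ i, Y i) ω - m / n = z
      rw [abs_div, abs_of_pos hm']
      have h2 : 1 / (2 * m * √m) * z ^ 2 + 1 / (2 * √m) - |z| / m =
          (|z| - √m) ^ 2 / (2 * m * √m) := by
        rw [sub_sq, sq_abs, Real.sq_sqrt hm'.le]
        field_simp
        ring
      have : 0 ≤ (|z| - √m) ^ 2 / (2 * m * √m) := by positivity
      linarith
    have hi : Integrable (fun ω => ((∑ i, Y i) ω - m / n) ^ 2) μ := by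
      have := hint fun η => ((∑ i, if η i = a then (1 : ℝ) else 0) - m / n) ^ 2
      simpa only [Finset.sum_apply] using this
    calc _ ≤ ∫ ω, (1 / (2 * m * √m)) * ((∑ i, Y i) ω - m / n) ^ 2 + 1 / (2 * √m) ∂μ :=
          integral_mono
            (hint fun η => |(1 / (m : ℝ)) * ∑ i, (if η i = a then 1 else 0) - 1 / (n : ℝ)|)
            ((hi.const_mul _).add (integrable_const _)) hpt
      _ = (1 / (2 * m * √m)) * ∫ ω, ((∑ i, Y i) ω - m / n) ^ 2 ∂μ + 1 / (2 * √m) := by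
          rw [integral_add (hi.const_mul _) (integrable_const _), integral_const_mul]
          simp
      _ ≤ (1 / (2 * m * √m)) * m + 1 / (2 * √m) := by gcongr
      _ = 1 / √m := by field_simp; norm_num
  simp only [freqDeviation]
  rw [integral_finsetSum _ fun a _ =>
    hint fun η => |(1 / (m : ℝ)) * ∑ i, (if η i = a then 1 else 0) - 1 / (n : ℝ)|]
  calc _ ≤ ∑ _a : Fin n, 1 / √(m : ℝ) := Finset.sum_le_sum fun a _ => key a
    _ = _ := by simp

end Sampling

/-! ### Batch sizes and the potential recursion -/

lemma inv_sqrt_batchSize_le {ρ : ℝ} (h1 : ρ < 1) (k : ℕ) :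
    1 / √(batchSize ρ k : ℝ) ≤ (1 - ρ) ^ (k + 1) := by
  have h2 : 0 < (1 - ρ) ^ (k + 1) := pow_pos (sub_pos.2 h1) _
  rw [one_div]
  refine inv_le_of_inv_le₀ h2 (Real.le_sqrt_of_sq_le ?_)
  refine le_trans (le_of_eq ?_) (Nat.le_ceil _)
  rw [inv_pow, ← pow_mul, one_div]
  congr 2
  ring

lemma batchSize_pos {ρ : ℝ} (h1 : ρ < 1) (k : ℕ) : 0 < batchSize ρ k :=
  Nat.ceil_pos.2 (one_div_pos.2 (pow_pos (sub_pos.2 h1) _))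

/-- A potential that contracts up to random errors with geometrically decaying mean is dominated by
integrable functions with geometrically decaying mean. -/
lemma exists_integrable_dominating {Ω : Type*} [MeasurableSpace Ω] {μ : Measure Ω}
    [IsProbabilityMeasure μ] {q r a c₀ : ℝ} (hr0 : 0 ≤ r) (hrq : r < q) (hr1 : r ≤ 1)
    (ha : 0 ≤ a) {e : ℕ → Ω → ℝ} {Φ : Ω → ℕ → ℝ} (he : ∀ k, 1 ≤ k → Integrable (e k) μ)
    (heint : ∀ k, 1 ≤ k → ∫ ω, e k ω ∂μ ≤ a * r ^ k) (h1 : ∀ ω, Φ ω 1 ≤ c₀)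
    (hstep : ∀ ω k, 1 ≤ k → Φ ω (k + 1) ≤ q * Φ ω k + e k ω) (j : ℕ) :
    ∃ d : Ω → ℝ, Integrable d μ ∧ (∀ ω, Φ ω (j + 1) ≤ d ω) ∧
      ∫ ω, d ω ∂μ ≤ (c₀ + a / (q - r)) * q ^ j - a / (q - r) * r ^ j := by
  have hqr : 0 < q - r := sub_pos.2 hrq
  have hq : 0 ≤ q := hr0.trans hrq.le
  -- The potential need not be measurable, since it involves the size of the active set; `d` is
  -- built only from the errors. The claimed bound solves b ↦ q·b + a·r^j exactly, which is why the
  -- negative term is kept.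
  induction j with
  | zero => exact ⟨fun _ => c₀, integrable_const _, h1, by simp⟩
  | succ j ih =>
    obtain ⟨d, hd, hle, hint⟩ := ih
    refine ⟨fun ω => q * d ω + e (j + 1) ω, (hd.const_mul q).add (he _ (by omega)),
      fun ω => (hstep ω (j + 1) (by omega)).trans ?_, ?_⟩
    · have := mul_le_mul_of_nonneg_left (hle ω) hq
      linarith
    · rw [integral_add (hd.const_mul q) (he _ (by omega)), integral_const_mul]
      have h2 := heint (j + 1) (by omega)
      have h3 := mul_le_mul_of_nonneg_left hint hq
      have h4 : a * r ^ (j + 1) ≤ a * r ^ j :=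
        mul_le_mul_of_nonneg_left (pow_le_pow_of_le_one hr0 hr1 (Nat.le_succ j)) ha
      have h5 : a / (q - r) * (q - r) = a := div_mul_cancel₀ a hqr.ne'
      have h6 : a * r ^ j = a / (q - r) * (q - r) * r ^ j := by rw [h5]
      rw [pow_succ, pow_succ]
      rw [pow_succ] at h2 h4
      linarith

/-- One step of the potential `gap * Q ^ |U|`, where `Q = 1 / q` and `q ^ 2` is the contraction
factor of a step that does not drop a vertex. -/
lemma potential_step {q Gx Gx' Gy Fx Fx' Fy e : ℝ} {c c' N : ℕ} (hq0 : 0 < q) (hq1 : q ≤ 1)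
    (hx : |Gx - Fx| ≤ e) (hx' : |Gx' - Fx'| ≤ e) (hy : |Gy - Fy| ≤ e) (hF : Fy ≤ Fx)
    (hN : c' ≤ N) (hmono : Gx' ≤ Gx)
    (hprog : Gy ≤ Gx → (Gx' - Gy ≤ q ^ 2 * (Gx - Gy) ∧ c' ≤ c + 1) ∨ c' + 1 ≤ c) :
    (Fx' - Fy) * q⁻¹ ^ c' ≤ q * ((Fx - Fy) * q⁻¹ ^ c) + q⁻¹ ^ N * (4 * e) := by
  have hQ : 1 ≤ q⁻¹ := (one_le_inv₀ hq0).2 hq1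
  rw [abs_le] at hx hx' hy
  have he : 0 ≤ e := by linarith
  have hQc : 0 < q⁻¹ ^ c := by positivity
  have hQc' : 0 < q⁻¹ ^ c' := by positivity
  have hh : 0 ≤ Fx - Fy := sub_nonneg.2 hF
  have hE : q⁻¹ ^ c' * (4 * e) ≤ q⁻¹ ^ N * (4 * e) :=
    mul_le_mul_of_nonneg_right (pow_le_pow_right₀ hQ hN) (by linarith)
  -- θ is the contraction of the gap up to sampling error: 0 if the sampled objective already lies
  -- below its value at the comparison point, q² for a contracting step, 1 for a drop.
  suffices h : ∃ θ, Fx' - Fy ≤ θ * (Fx - Fy) + 4 * e ∧ θ * q⁻¹ ^ c' ≤ q * q⁻¹ ^ c by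
    obtain ⟨θ, h1, h2⟩ := h
    have h3 := mul_le_mul_of_nonneg_right h1 hQc'.le
    have h4 := mul_le_mul_of_nonneg_right h2 hh
    linarith
  rcases lt_or_ge Gx Gy with hlt | hge
  · exact ⟨0, by linarith, by rw [zero_mul]; positivity⟩
  rcases hprog hge with ⟨h1, h2⟩ | h1
  · refine ⟨q ^ 2, ?_, ?_⟩
    · have h3 : q ^ 2 * (Gx - Gy) ≤ q ^ 2 * (Fx - Fy + 2 * e) :=
        mul_le_mul_of_nonneg_left (by linarith) (by positivity)
      have h4 : q ^ 2 * (2 * e) ≤ 1 * (2 * e) :=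
        mul_le_mul_of_nonneg_right (pow_le_one₀ hq0.le hq1) (by linarith)
      linarith
    · have h3 := mul_le_mul_of_nonneg_left (pow_le_pow_right₀ hQ h2) (by positivity : 0 ≤ q ^ 2)
      refine h3.trans (le_of_eq ?_)
      rw [pow_succ q⁻¹ c]
      field_simp
  · refine ⟨1, by linarith, ?_⟩
    have h3 := mul_le_mul_of_nonneg_left (pow_le_pow_right₀ hQ h1) hq0.le
    refine le_trans (le_of_eq ?_) h3
    rw [pow_succ]
    field_simp

lemma IsUniformSampling.pairwise_indepFun {n : ℕ} {Ω : Type*} [MeasurableSpace Ω] {μ : Measure Ω}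
    {M : ℕ → ℕ} {ξ : (k : ℕ) → Fin (M k) → Ω → Fin n} (h : IsUniformSampling μ ξ) {k : ℕ}
    (hk : 1 ≤ k) : Pairwise fun i j => IndepFun (ξ k i) (ξ k j) μ := by
  intro i j hij
  refine h.indep.indepFun (i := ⟨⟨k, hk⟩, i⟩) (j := ⟨⟨k, hk⟩, j⟩) fun h' => hij ?_
  exact eq_of_heq (Sigma.mk.inj h').2

lemma one_sub_rpow_half_mul {β : ℝ} (hβ : β < 1) {k : ℕ} (hk : 1 ≤ k) :
    (1 - β) ^ (((k : ℝ) - 1) / 2) = √(1 - β) ^ (k - 1) := by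
  rw [Real.sqrt_eq_rpow, ← Real.rpow_natCast, ← Real.rpow_mul (sub_pos.2 hβ).le,
    Nat.cast_sub hk, Nat.cast_one]
  congr 1
  ring

end ASFW

/-! ### The convergence theorem -/

open ASFW in
theorem theorem1 {n p c : ℕ} (hn : 0 < n)
    (C : Matrix (Fin c) (Fin p) ℝ) (b : Fin c → ℝ)
    (hcompact : IsCompact (ASFW.polyhedron C b)) (hnontriv : (ASFW.polyhedron C b).Nontrivial)
    (f : Fin n → ASFW.E p → ℝ) (σ : Fin n → ℝ) (L : Fin n → ℝ≥0)
    (hσ : ∀ i, 0 < σ i) (hconvex : ∀ i, StrongConvexOn Set.univ (σ i) (f i))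
    (hdiff : ∀ i, Differentiable ℝ (f i)) (hlip : ∀ i, LipschitzWith (L i) (gradient (f i)))
    (cara : Bool) :
    ∃ C₂ β : ℝ, 0 < β ∧ β < ASFW.rho C b σ L cara ∧ ASFW.rho C b σ L cara ≤ 1 / 2 ∧
      ∀ (Ω : Type*) [MeasurableSpace Ω] (μ : Measure Ω) [IsProbabilityMeasure μ]
        (ξ : (k : ℕ) → Fin (ASFW.batchSize (ASFW.rho C b σ L cara) k) → Ω → Fin n)
        (v : ASFW.E p) (s : Ω → ℕ → ASFW.State p),
        ASFW.IsUniformSampling μ ξ → v ∈ ASFW.vertices C b →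
        (∀ ω, ASFW.IsRun C b f L cara v (fun k i => ξ k i ω) (s ω)) →
        (∀ k, 1 ≤ k → Measurable fun ω => (s ω k).x) →
        ∀ k : ℕ, 1 ≤ k →
          Integrable (fun ω => ASFW.objective f (s ω (k + 1)).x -
              ASFW.optimalValue f (ASFW.polyhedron C b)) μ ∧
            ∫ ω, (ASFW.objective f (s ω (k + 1)).x -
              ASFW.optimalValue f (ASFW.polyhedron C b)) ∂μ ≤
              C₂ * (1 - β) ^ (((k : ℝ) - 1) / 2) := by
  have hnE : Nonempty (Fin n) := ⟨⟨0, hn⟩⟩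
  have hntE : Nontrivial (E p) := by
    obtain ⟨x, -, y, -, hxy⟩ := hnontriv
    exact ⟨x, y, hxy⟩
  have hLpos : ∀ i, 0 < L i := fun i =>
    pos_of_strongConvexOn_of_lipschitzWith_gradient (hσ i) (hconvex i) (hdiff i) (hlip i)
  have hρ0 := rho_pos hn hcompact hnontriv hσ hLpos cara
  have hρ1 : rho C b σ L cara ≤ 1 / 2 := min_le_left _ _
  set ρ := rho C b σ L cara with hρ
  obtain ⟨K, hK, hgap⟩ := exists_inner_le_mul_vertex_gap hcompact
  -- the common constants of the component functions
  set τ := ⨅ i, σ i with hτdef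
  have hτ : 0 < τ := by
    obtain ⟨i, hi⟩ := exists_eq_ciInf_of_finite (f := σ)
    rw [hτdef, ← hi]; exact hσ i
  have hconvτ : ∀ i, StrongConvexOn Set.univ τ (f i) := fun i =>
    (hconvex i).mono (ciInf_le (Set.finite_range σ).bddBelow i)
  set M := ⨆ i, (L i : ℝ) with hMdef
  have hM : ∀ i, (L i : ℝ) ≤ M := le_ciSup (f := fun i => (L i : ℝ)) (Set.finite_range _).bddAbove
  have hM0 : 0 < M := lt_of_lt_of_le (NNReal.coe_pos.2 (hLpos ⟨0, hn⟩)) (hM ⟨0, hn⟩)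
  set D := Metric.diam (polyhedron C b) with hDdef
  have hD0 : 0 < D := Metric.diam_pos hnontriv hcompact.isBounded
  have hD : ∀ x ∈ polyhedron C b, ∀ y ∈ polyhedron C b, ‖x - y‖ ≤ D := fun x hx y hy => by
    rw [← dist_eq_norm]; exact Metric.dist_le_diam_of_mem hcompact.isBounded hx hy
  -- the contraction factor
  set β := min (ρ / 2) (τ / (4 * K ^ 2 * M * D ^ 2)) with hβdef
  have hβ0 : 0 < β := lt_min (by linarith) (by positivity)
  have hβρ : β < ρ := lt_of_le_of_lt (min_le_left _ _) (by linarith)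
  have hβτ : β * (4 * K ^ 2 * M * D ^ 2) ≤ τ := (le_div_iff₀ (by positivity)).1 (min_le_right _ _)
  set q := √(1 - β) with hqdef
  have hq2 : q ^ 2 = 1 - β := Real.sq_sqrt (by linarith)
  have hq0 : 0 < q := Real.sqrt_pos.2 (by linarith)
  have hq1 : q ≤ 1 := Real.sqrt_le_one.2 (by linarith)
  -- The sampling errors must decay strictly faster than the potential: 1 - ρ < 1 - β = q² ≤ q. This
  -- is why β is taken strictly below ρ.
  have hrq : 1 - ρ < q := by
    have : q ^ 2 ≤ q := by rw [pow_two]; exact mul_le_of_le_one_left hq0.le hq1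
    linarith
  have hQ : 1 ≤ q⁻¹ := (one_le_inv₀ hq0).2 hq1
  -- bounds for the objective
  have hFcont : Continuous (objective f) := by
    unfold objective
    exact continuous_const.mul (continuous_finsetSum _ fun i _ => (hdiff i).continuous)
  obtain ⟨y, hy, hymin⟩ := hcompact.exists_isMinOn hnontriv.nonempty hFcont.continuousOn
  have hopt : optimalValue f (polyhedron C b) = objective f y :=
    IsLeast.csInf_eq ⟨⟨y, hy, rfl⟩, by rintro _ ⟨x, hx, rfl⟩; exact hymin hx⟩
  obtain ⟨B₀, hB₀⟩ := hcompact.exists_bound_of_continuousOn (f := fun x => objective f x -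
    objective f y) (hFcont.sub continuous_const).continuousOn
  have hbound : ∃ B : ℝ, ∀ x ∈ polyhedron C b, ∀ a, |f a x| ≤ B := by
    choose B hB using fun a => hcompact.exists_bound_of_continuousOn (hdiff a).continuous.continuousOn
    refine ⟨∑ a, |B a|, fun x hx a => ((hB a x hx).trans (le_abs_self _)).trans ?_⟩
    exact Finset.single_le_sum (f := fun a => |B a|) (fun _ _ => abs_nonneg _) (Finset.mem_univ a)
  obtain ⟨B, hB⟩ := hbound
  have hB0 : 0 ≤ B := (abs_nonneg _).trans (hB y hy ⟨0, hn⟩)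
  set V := (finite_vertices C b).toFinset with hV
  have hrepP : ∀ t : State p, IsVertexRepresentation V t → t.x ∈ polyhedron C b := fun t ht => by
    rw [← ht.sum_smul]
    exact convex_polyhedron.sum_mem (fun v _ => ht.nonneg v) ht.sum_weights fun v hv =>
      vertices_subset ((Set.Finite.mem_toFinset _).1 hv)
  -- In both versions the active set is bounded by the full vertex set; the sharper bound p + 1 is
  -- not needed.
  set A := q⁻¹ ^ V.card * (4 * B) with hA
  have hA0 : 0 ≤ A := by positivity
  have hB₀0 : 0 ≤ B₀ := (norm_nonneg _).trans (hB₀ y hy)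
  -- The first term bounds the initial potential, with one active vertex; the second is the
  -- geometric sum of the mean errors.
  refine ⟨B₀ * q⁻¹ + A * n / (q - (1 - ρ)), β, hβ0, hβρ, hρ1, ?_⟩
  intro Ω _ μ _ ξ v s hξ hv hrun hmeas k hk
  have hm : ∀ k, 0 < batchSize ρ k := batchSize_pos (by linarith)
  have hvV : v ∈ V := (Set.Finite.mem_toFinset _).2 hv
  have hprog := fun ω k (hk : 1 ≤ k) (hs : IsVertexRepresentation V (s ω k)) =>
    IsIteration.progress (hm k) hdiff hlip hτ hconvτ hLpos hM hD hK hgap hβ0.le (by linarith) hβτ hs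
      ((hrun ω).2 k hk)
  have hrep : ∀ ω k, 1 ≤ k → IsVertexRepresentation V (s ω k) := by
    intro ω k hk
    induction k, hk using Nat.le_induction with
    | base => rw [(hrun ω).1]; exact IsVertexRepresentation.initialState hvV
    | succ k hk ih => exact (hprog ω k hk ih).1
  have hxP : ∀ ω k, 1 ≤ k → (s ω k).x ∈ polyhedron C b := fun ω k hk => hrepP _ (hrep ω k hk)
  rw [hopt]
  have hintegrable : Integrable (fun ω => objective f (s ω (k + 1)).x - objective f y) μ := by
    refine Integrable.of_bound (C := B₀) ?_ (ae_of_all _ fun ω => hB₀ _ (hxP ω _ (by omega)))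
    exact ((hFcont.measurable.comp (hmeas (k + 1) (by omega))).sub_const _).aestronglyMeasurable
  refine ⟨hintegrable, ?_⟩
  let e : ℕ → Ω → ℝ := fun k ω => A * freqDeviation fun i => ξ k i ω
  let Φ : Ω → ℕ → ℝ := fun ω k => (objective f (s ω k).x - objective f y) * q⁻¹ ^ (s ω k).U.card
  have hinit : ∀ ω, Φ ω 1 ≤ B₀ * q⁻¹ := fun ω => by
    have h1 : (s ω 1).U.card = 1 := by rw [(hrun ω).1]; simp [initialState]
    simp only [Φ, h1, pow_one]
    exact mul_le_mul_of_nonneg_right ((le_abs_self _).trans (hB₀ _ (hxP ω 1 le_rfl)))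
      (by positivity)
  have hstep : ∀ ω k, 1 ≤ k → Φ ω (k + 1) ≤ q * Φ ω k + e k ω := fun ω k hk => by
    obtain ⟨h1, h2, h3⟩ := hprog ω k hk (hrep ω k hk)
    have hdev : ∀ x ∈ polyhedron C b, |sampledObjective f (fun i => ξ k i ω) x - objective f x| ≤
        B * freqDeviation fun i => ξ k i ω := fun x hx =>
      abs_sampledObjective_sub_objective_le (hB x hx) _
    have := potential_step hq0 hq1 (hdev _ (hxP ω k hk)) (hdev _ (hxP ω (k + 1) (by omega)))
      (hdev y hy) (hymin (hxP ω k hk)) (Finset.card_le_card h1.subset) h2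
      (by rw [hq2]; exact h3 y hy)
    refine this.trans (le_of_eq ?_)
    simp only [Φ, e, hA]
    ring
  have he : ∀ k, 1 ≤ k → Integrable (e k) μ := fun k hk =>
    (integrable_freqDeviation (hξ.measurable k hk)).const_mul A
  have heint : ∀ k, 1 ≤ k → ∫ ω, e k ω ∂μ ≤ A * n * (1 - ρ) ^ k := fun k hk => by
    simp only [e]
    rw [integral_const_mul, mul_assoc A]
    refine mul_le_mul_of_nonneg_left ((integral_freqDeviation_le (hm k) (hξ.measurable k hk)
      (hξ.uniform k hk) (hξ.pairwise_indepFun hk)).trans ?_) hA0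
    refine mul_le_mul_of_nonneg_left ((inv_sqrt_batchSize_le (by linarith) k).trans ?_)
      (Nat.cast_nonneg n)
    exact pow_le_pow_of_le_one (by linarith) (by linarith) (Nat.le_succ k)
  obtain ⟨d, hd, hle, hint⟩ := exists_integrable_dominating (by linarith) hrq (by linarith)
    (by positivity) he heint hinit hstep k
  have hqr : 0 < q - (1 - ρ) := sub_pos.2 hrq
  rw [one_sub_rpow_half_mul (by linarith) hk, ← hqdef]
  calc ∫ ω, (objective f (s ω (k + 1)).x - objective f y) ∂μ ≤ ∫ ω, d ω ∂μ := by
        refine integral_mono hintegrable hd fun ω => le_trans ?_ (hle ω)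
        -- The factor q⁻¹^|U| is at least 1, so the gap is at most the potential.
        exact le_mul_of_one_le_right (sub_nonneg.2 (hymin (hxP ω _ (by omega))))
          (one_le_pow₀ hQ)
    _ ≤ (B₀ * q⁻¹ + A * n / (q - (1 - ρ))) * q ^ k := by
        refine hint.trans (sub_le_self _ ?_)
        have : 0 ≤ 1 - ρ := by linarith
        positivity
    _ ≤ (B₀ * q⁻¹ + A * n / (q - (1 - ρ))) * q ^ (k - 1) :=
        mul_le_mul_of_nonneg_left (pow_le_pow_of_le_one hq0.le hq1 (Nat.sub_le k 1))
          (by positivity)
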